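/- Conventions. A *cactus* is obtained from a disk with boundary points $w_1,\dots,w_n$ ($n\ge 1$, in clockwise order, indices modulo $n$) by gluing these points along a noncrossing partition. A *black-trivalent bipartite (BTB) graph* is a bipartite graph $G$ embedded in a cactus, with boundary white vertices $w_1,\dots,w_n$ (possibly with identifications), all of whose black vertices are trivalent; it corresponds to a triple crossing diagram $\mathcal T$, whose clockwise faces, triple crossings and counterclockwise faces are the white vertices, black vertices and faces of $G$. Its *strands* are given by the zig-zag paths, which turn maximally left at white vertices and maximally right at black vertices. The strand starting at the source $i$ begins at $w_i$ along its leftmost edge; a strand ends at the sink $\bar\jmath$ when it leaves the graph at $w_j$ after arriving along the rightmost edge (the strand $i$ of an unglued isolated $w_i$ ends at $\bar\imath$). The *strand permutation* is $C_{\mathcal T}(i)=j$ if the strand from source $i$ ends at sink $\bar\jmath$. The graph $G$ is *minimal* if no strand is a closed loop, no strand uses an edge in both directions, and there are no two different strands that both pass through two distinct edges $e_1,e_2$ in the same order, $e_1$ before $e_2$. All graphs $G$ of triple crossing diagrams considered below are minimal. Section graphs. Suppose that no two consecutive boundary white vertices are glued, i.e. $w_i\ne w_{i+1}$ for all $i$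 modulo $n$. Put a black vertex $b_{i,i+1}$ on the boundary arc between $w_i$ and $w_{i+1}$, joined to both along the boundary. The *star graph* of $G$ has a white vertex $\hat w_b$ for each black vertex $b$ (including the $b_{i,i+1}$), a black vertex $\hat b_f$ in each face $f$, and an edge $\hat b_f\hat w_b$ for each corner of $f$ at $b$; it lies in the disk, and $\hat w_{b_{i,i+1}}$ is its $i$-th boundary white vertex. A *section graph* $\sigma(G)$, with triple crossing diagram $\sigma(\mathcal T)$, is any BTB graph obtained from the star graph by first replacing each black vertex of degree greater than $3$ by a plane bipartite tree with trivalent black vertices and white vertices of degree $2$ (by successively splitting black vertices), and then contracting all black vertices of degree $2$, where contracting one between two boundary vertices glues them. For an edge $e=bw$ of $G$, let $\hat e=\hat b_f\hat w_b$ be the edge of the star graph at the corner of $b$ not adjacent to $e$. **Proposition.** Let $G$ be a minimal BTB graph, with triple crossing diagram $\mathcal T$, in which no two consecutive boundary white vertices are glued, and let $\sigma(G)$ be any section graph of $G$. Then: 1. There is a natural bijection $\Phi$ between the strands of $G$ and the strands of $\sigma(G)$: it sends the strand with source $i$ to the strand with source $i$, and, whenever $e$ is an edge of $G$ such that $\hat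 e$ survives in $\sigma(G)$, it sends the strand of $G$ using $e$ in a given direction (black-to-white or white-to-black) to the strand of $\sigma(G)$ using $\hat e$ in the same direction. 2. $C_{\sigma(\mathcal T)}(i)=C_{\mathcal T}(i)-1 \pmod n$ for all $i$. 3. $\sigma(G)$ is a minimal BTB graph (black-trivalent and embedded in a cactus with $n$ boundary vertices). -/

import Mathlib

/-!
Planar bipartite graphs in a cactus, encoded by their rotation system.

A bipartite graph with `n` boundary white vertices `w_i`, `i ∈ ZMod n` (labelled in clockwise
order), embedded in a cactus `𝔻/π`, is recorded by

* the finite set `E` of its edges;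
* for every `i` one *boundary leg* `inr i`, which sits at the boundary white vertex `w_i` and points
  to the outside of the cactus between the sink `i-bar` and the source `i`.  Two boundary vertices
  `w_i`, `w_j` are glued exactly if the legs `i` and `j` sit at the same white vertex;
* the permutation `black` of `E`, sending an edge to the next edge counterclockwise around its
  black endpoint;
* the permutation `white` of edges and legs, sending an edge or leg to the next edge or leg
  counterclockwise around its white vertex.

So black vertices are the cycles of `black`, white vertices are the cycles of `white`, and a white
vertex is a boundary vertex exactly if its cycle contains a leg.
-/

/-- The rotation system of a bipartite graph with `n` boundary white vertices. Multiple edges are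
allowed and the degrees of the vertices are arbitrary. -/
structure BoundaryGraph (n : ℕ) where
  /-- the edges -/
  E : Type
  /-- there are finitely many edges -/
  finite : Finite E
  /-- counterclockwise rotation of the edges around the black vertices -/
  black : Equiv.Perm E
  /-- counterclockwise rotation of the edges and boundary legs around the white vertices -/
  white : Equiv.Perm (E ⊕ ZMod n)

/-- The number of cycles of a permutation, fixed points included. -/
noncomputable def numCycles {α : Type} (p : Equiv.Perm α) : ℕ :=
  Nat.card (Quotient (Equiv.Perm.SameCycle.setoid p))

namespace BoundaryGraph

variable {n : ℕ}

/-- The edges together with the boundary legs. -/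
abbrev Half (G : BoundaryGraph n) : Type := G.E ⊕ ZMod n

/-- The two boundary white vertices `w_i` and `w_j` are the same point of the cactus. -/
def Glued (G : BoundaryGraph n) (i j : ZMod n) : Prop :=
  G.white.SameCycle (Sum.inr i) (Sum.inr j)

/-- The rotation around the black vertices, when the exterior of the cactus is collapsed to one
additional black vertex `∞` at which all legs end. The clockwise order of the labels, seen from the
cactus, is the counterclockwise order around `∞`. -/
def outerBlack (G : BoundaryGraph n) : Equiv.Perm G.Half :=
  Equiv.sumCongr G.black (Equiv.addRight (1 : ZMod n))

/-- The face permutation. An edge `e` stands for the corner at the black endpoint of `e` between `e`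
and `black e`; the leg `i` stands for the corner, inside the cactus, of the boundary black vertex
`b_{i,i+1}` placed on the boundary arc between `w_i` and `w_{i+1}` (equivalently, for the corner at
`∞` between the legs `i` and `i+1`). `face` sends such a corner to the next one in counterclockwise
order around its face. The cycles are the faces, and the cycle of the leg `i` is the boundary face
`f_{i,i+1}`. -/
def face (G : BoundaryGraph n) : Equiv.Perm G.Half :=
  G.outerBlack⁻¹ * G.white⁻¹

/-- The rotation system is that of a (connected) graph on the sphere, i.e. the original graph is
embedded in a cactus, with `w_1, …, w_n` in clockwise order along the boundary: the graph with the
additional vertex `∞` is connected and has Euler characteristic `2`. -/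
def IsPlanar (G : BoundaryGraph n) : Prop :=
  MulAction.IsPretransitive
      (Subgroup.closure ({G.white, G.outerBlack} : Set (Equiv.Perm G.Half))) G.Half ∧
    numCycles G.white + numCycles G.outerBlack + numCycles G.face = Nat.card G.Half + 2

/-- Every black vertex has degree `3`. -/
def IsTrivalent (G : BoundaryGraph n) : Prop :=
  ∀ e, G.black e ≠ e ∧ G.black (G.black (G.black e)) = e

/-- Black-trivalent bipartite graphs in a cactus. -/
structure IsBTB (G : BoundaryGraph n) : Prop where
  planar : G.IsPlanar
  trivalent : G.IsTrivalent

/-! ### Zig-zag paths, strands, minimality -/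

/-- An edge (or leg) together with a direction of traversal. The leg `i` traversed towards the white
vertex `w_i` is the source `i`; traversed away from `w_i` it is the sink `i-bar`. -/
inductive Dart (G : BoundaryGraph n) : Type
  | toWhite (x : G.Half) : Dart G
  | fromWhite (x : G.Half) : Dart G

/-- One step of a zig-zag path (equivalently, of a medial strand): turn maximally left at a white
vertex (continue along the next edge clockwise), turn maximally right at a black vertex (continue
along the next edge counterclockwise). A path that leaves along a leg stops. -/
inductive Next (G : BoundaryGraph n) : G.Dart → G.Dart → Prop
  | atWhite (x : G.Half) : Next G (.toWhite x) (.fromWhite (G.white⁻¹ x))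
  | atBlack (e : G.E) : Next G (.fromWhite (Sum.inl e)) (.toWhite (Sum.inl (G.black e)))

/-- `d` occurs on the zig-zag path that goes through `c`, at `c` or later. -/
def Reaches (G : BoundaryGraph n) (c d : G.Dart) : Prop :=
  Relation.ReflTransGen G.Next c d

/-- The source `i`, just clockwise of `w_i`. -/
def source (G : BoundaryGraph n) (i : ZMod n) : G.Dart := .toWhite (Sum.inr i)

/-- The sink `j-bar`, just counterclockwise of `w_j`. -/
def sink (G : BoundaryGraph n) (j : ZMod n) : G.Dart := .fromWhite (Sum.inr j)

/-- Strands, both arcs and closed loops: the classes of directed edges that lie on a common zig-zag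
path. -/
def Strand (G : BoundaryGraph n) : Type := Quot G.Next

/-- The strand through a directed edge. -/
def strandOf (G : BoundaryGraph n) (d : G.Dart) : G.Strand := Quot.mk _ d

theorem next_rightUnique (G : BoundaryGraph n) : Relator.RightUnique G.Next := by
  intro a b c hb hc
  cases hb <;> cases hc <;> rfl

theorem next_leftUnique (G : BoundaryGraph n) {a b c : G.Dart} (hb : G.Next b a)
    (hc : G.Next c a) : b = c := by
  cases a with
  | toWhite x =>
    generalize hd : Dart.toWhite x = d at hb hc
    cases hb with
    | atWhite y => cases hd
    | atBlack e =>
      generalize hd' : Dart.toWhite (Sum.inl (G.black e)) = d' at hc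
      cases hc with
      | atWhite y => cases hd'
      | atBlack f =>
        simp only [Dart.toWhite.injEq, Sum.inl.injEq, EmbeddingLike.apply_eq_iff_eq] at hd'
        rw [hd']
  | fromWhite x =>
    generalize hd : Dart.fromWhite x = d at hb hc
    cases hb with
    | atBlack e => cases hd
    | atWhite y =>
      generalize hd' : Dart.fromWhite (G.white⁻¹ y) = d' at hc
      cases hc with
      | atBlack f => cases hd'
      | atWhite z =>
        simp only [Dart.fromWhite.injEq, EmbeddingLike.apply_eq_iff_eq] at hd'
        rw [hd']

theorem not_next_source (G : BoundaryGraph n) (d : G.Dart) (i : ZMod n) :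
    ¬ G.Next d (G.source i) := by
  intro h
  generalize hd : G.source i = c at h
  cases h <;> simp [source] at hd

theorem not_sink_next (G : BoundaryGraph n) (d : G.Dart) (j : ZMod n) :
    ¬ G.Next (G.sink j) d := by
  intro h
  generalize hd : G.sink j = c at h
  cases h <;> simp [sink] at hd

theorem source_injective_of_reaches (G : BoundaryGraph n) {i i' : ZMod n} {d : G.Dart}
    (h : G.Reaches (G.source i) d) (h' : G.Reaches (G.source i') d) : i = i' := by
  have key : ∀ {a b : ZMod n}, G.Reaches (G.source a) (G.source b) → a = b := by
    intro a b hab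
    rcases Relation.ReflTransGen.cases_tail hab with h | ⟨c, -, h⟩
    · simpa [source] using h.symm
    · exact absurd h (G.not_next_source _ _)
  have hU : Relator.RightUnique (Function.swap G.Next) := fun _ _ _ hb hc => G.next_leftUnique hb hc
  rcases Relation.ReflTransGen.total_of_right_unique hU
    (Relation.reflTransGen_swap.2 h) (Relation.reflTransGen_swap.2 h') with h | h
  · exact (key (Relation.reflTransGen_swap.1 h)).symm
  · exact key (Relation.reflTransGen_swap.1 h)

theorem sink_unique_of_reaches (G : BoundaryGraph n) {d : G.Dart} {j j' : ZMod n}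
    (h : G.Reaches d (G.sink j)) (h' : G.Reaches d (G.sink j')) : j = j' := by
  have key : ∀ {a b : ZMod n}, G.Reaches (G.sink a) (G.sink b) → a = b := by
    intro a b hab
    rcases Relation.ReflTransGen.cases_head hab with h | ⟨c, h, -⟩
    · simpa [sink] using h
    · exact absurd h (G.not_sink_next _ _)
  rcases Relation.ReflTransGen.total_of_right_unique G.next_rightUnique h h' with h | h
  · exact key h
  · exact (key h).symm

/-- The zig-zag path that starts at the source `i` ends at some sink. -/
theorem exists_sink [NeZero n] (G : BoundaryGraph n) (i : ZMod n) :
    ∃ j, G.Reaches (G.source i) (G.sink j) := by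
  classical
  have := G.finite
  let Z : Equiv.Perm G.Half := Equiv.sumCongr G.black (Equiv.refl (ZMod n)) * G.white⁻¹
  have hex : ∃ m : ℕ, ∃ j : ZMod n, G.white⁻¹ ((Z ^ m) (Sum.inr i)) = Sum.inr j := by
    obtain ⟨k, hk, hZ⟩ := isOfFinOrder_iff_pow_eq_one.1 (isOfFinOrder_of_finite Z)
    obtain ⟨m, rfl⟩ : ∃ m, k = m + 1 := ⟨k - 1, by omega⟩
    refine ⟨m, i, ?_⟩
    have h1 : Z ((Z ^ m) (Sum.inr i)) = Sum.inr i := by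
      rw [← Equiv.Perm.mul_apply, ← pow_succ', hZ, Equiv.Perm.one_apply]
    have h2 : Equiv.sumCongr G.black (Equiv.refl (ZMod n))
        (G.white⁻¹ ((Z ^ m) (Sum.inr i))) = Sum.inr i := h1
    rcases hx : G.white⁻¹ ((Z ^ m) (Sum.inr i)) with e | j
    · rw [hx] at h2; simp at h2
    · rw [hx] at h2; simpa using h2
  obtain ⟨j, hj⟩ := Nat.find_spec hex
  have hpath : ∀ l ≤ Nat.find hex, G.Reaches (G.source i) (.toWhite ((Z ^ l) (Sum.inr i))) := by
    intro l
    induction l with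
    | zero => intro _; exact Relation.ReflTransGen.refl
    | succ l ih =>
      intro hl
      have hnot := Nat.find_min hex (Nat.lt_of_succ_le hl)
      rcases hx : G.white⁻¹ ((Z ^ l) (Sum.inr i)) with e | j
      · have h1 : (Z ^ (l + 1)) (Sum.inr i) = Sum.inl (G.black e) := by
          rw [pow_succ', Equiv.Perm.mul_apply]
          change Equiv.sumCongr G.black (Equiv.refl (ZMod n))
            (G.white⁻¹ ((Z ^ l) (Sum.inr i))) = _
          rw [hx]; rfl
        rw [h1]
        refine ((ih (by omega)).tail (Next.atWhite _)).tail ?_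
        rw [hx]
        exact Next.atBlack e
      · exact absurd ⟨j, hx⟩ hnot
  refine ⟨j, (hpath _ le_rfl).tail ?_⟩
  have := Next.atWhite (G := G) ((Z ^ Nat.find hex) (Sum.inr i))
  rw [hj] at this
  exact this

/-- The strand permutation: `strandPerm i = j` if there is a strand from the source `i` to the sink
`j-bar`. -/
noncomputable def strandPerm [NeZero n] (G : BoundaryGraph n) : Equiv.Perm (ZMod n) :=
  Equiv.ofBijective (fun i => (G.exists_sink i).choose)
    (Finite.injective_iff_bijective.1 fun i i' h => by
      have h1 := (G.exists_sink i).choose_spec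
      have h2 := (G.exists_sink i').choose_spec
      exact G.source_injective_of_reaches h1 (h ▸ h2))

theorem strandPerm_eq_iff [NeZero n] (G : BoundaryGraph n) (i j : ZMod n) :
    G.strandPerm i = j ↔ G.Reaches (G.source i) (G.sink j) := by
  have h : G.Reaches (G.source i) (G.sink (G.strandPerm i)) := (G.exists_sink i).choose_spec
  exact ⟨fun hj => hj ▸ h, fun hj => G.sink_unique_of_reaches h hj⟩

/-- The directed edge `d` is a traversal of the edge `e`, in one of the two directions. -/
def Dart.IsOver {G : BoundaryGraph n} (d : G.Dart) (e : G.E) : Prop :=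
  d = .toWhite (Sum.inl e) ∨ d = .fromWhite (Sum.inl e)

/-- The strand from the source `i` goes through the edges `e` and `f`, oriented from `e` to `f`. -/
def PassesInOrder (G : BoundaryGraph n) (i : ZMod n) (e f : G.E) : Prop :=
  ∃ c d : G.Dart, c.IsOver e ∧ d.IsOver f ∧ G.Reaches (G.source i) c ∧ G.Reaches c d

/-- Minimal (reduced) graphs. The edges of the graph are the vertices of its medial graph. -/
structure IsMinimal (G : BoundaryGraph n) : Prop where
  /-- no strand is a closed loop -/
  no_loop : ∀ d : G.Dart, ¬ Relation.TransGen G.Next d d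
  /-- no strand goes through an edge twice, that is, in both directions -/
  no_self_intersection : ∀ (i : ZMod n) (e : G.E),
    ¬ (G.Reaches (G.source i) (.toWhite (Sum.inl e)) ∧
      G.Reaches (G.source i) (.fromWhite (Sum.inl e)))
  /-- no two strands go through two distinct edges in the same order -/
  no_parallel_bigon : ∀ i j : ZMod n, i ≠ j → ∀ e f : G.E, e ≠ f →
    ¬ (G.PassesInOrder i e f ∧ G.PassesInOrder j e f)

/-! ### The star graph -/

/-- The star graph of a graph in which no two consecutive boundary vertices are glued (so that no
disk of the cactus has to be removed).

Its white vertices are the black vertices `b` of the graph and the boundary black vertices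
`b_{i,i+1}`; its black vertices are the faces; its edges are the corners of faces at black vertices,
numbered as for `face`: the edge `inl e` is the corner between `e` and `black e`, and the edge
`inr i` is the corner at `b_{i,i+1}`. The white vertex at `b_{i,i+1}` is the `i`-th boundary vertex,
and the edge `inr i` is the only edge there. -/
def star [NeZero n] (G : BoundaryGraph n) : BoundaryGraph n where
  E := G.E ⊕ ZMod n
  finite := have := G.finite; inferInstance
  black := G.face
  white := (Equiv.sumAssoc G.E (ZMod n) (ZMod n)).trans
    ((Equiv.sumCongr G.black (Equiv.sumComm (ZMod n) (ZMod n))).trans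
      (Equiv.sumAssoc G.E (ZMod n) (ZMod n)).symm)

/-! ### Splits and contractions -/

open Classical in
/-- Remove a point from its cycle, leaving it as a fixed point. -/
noncomputable def removePoint {α : Type} (p : Equiv.Perm α) (x : α) : Equiv.Perm α :=
  Equiv.swap x (p x) * p

open Classical in
/-- For `x` and `y` in different cycles `(x a₁ … aₖ)` and `(y b₁ … bₗ)` of `p`, replace these cycles
by `(a₁ … aₖ b₁ … bₗ)` and fix `x` and `y`. This is the rotation after the contraction of a vertex
of degree `2` with the edges `x` and `y`. -/
noncomputable def mergeCycles {α : Type} (p : Equiv.Perm α) (x y : α) : Equiv.Perm α :=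
  removePoint (removePoint (p * Equiv.swap x y) x) y

/-- `H` arises from `G` by splitting one black vertex, and `ι` is the inclusion of the edges: the
black vertex is replaced by two black vertices of degree at least `3`, joined through a new white
vertex of degree `2` with the edges `x` and `y`. In other words, contracting that white vertex of
`H` gives `G`. -/
def IsSplit (G H : BoundaryGraph n) (ι : G.E → H.E) : Prop :=
  Function.Injective ι ∧
  ∃ x y : H.E, x ≠ y ∧ Set.range ι = {x, y}ᶜ ∧
    H.white (Sum.inl x) = Sum.inl y ∧ H.white (Sum.inl y) = Sum.inl x ∧
    ¬ H.black.SameCycle x y ∧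
    H.black (H.black x) ≠ x ∧ H.black (H.black y) ≠ y ∧
    (∀ e, ι (G.black e) = mergeCycles H.black x y (ι e)) ∧
    (∀ z, Sum.map ι id (G.white z) = H.white (Sum.map ι id z))

/-- `H` arises from `G` by contracting one black vertex of degree `2`, with the edges `x` and `y`
leading to two different white vertices, and `ι` is the inclusion of the remaining edges. If both
white vertices are boundary vertices, they become glued. -/
def IsContraction (G H : BoundaryGraph n) (ι : H.E → G.E) : Prop :=
  Function.Injective ι ∧
  ∃ x y : G.E, x ≠ y ∧ Set.range ι = {x, y}ᶜ ∧
    G.black x = y ∧ G.black y = x ∧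
    ¬ G.white.SameCycle (Sum.inl x) (Sum.inl y) ∧
    (∀ e, ι (H.black e) = G.black (ι e)) ∧
    (∀ z, Sum.map ι id (H.white z) =
      mergeCycles G.white (Sum.inl x) (Sum.inl y) (Sum.map ι id z))

/-- `H` arises from `G` by finitely many splits of black vertices, and `ι` is the inclusion of the
edges. -/
inductive Splits (G : BoundaryGraph n) : (H : BoundaryGraph n) → (G.E → H.E) → Prop
  | refl : Splits G G id
  | step {H K : BoundaryGraph n} {ι : G.E → H.E} {κ : H.E → K.E} :
      Splits G H ι → IsSplit H K κ → Splits G K (κ ∘ ι)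

/-- `H` arises from `G` by finitely many contractions of black vertices of degree `2`, and `ι` is
the inclusion of the remaining edges. -/
inductive Contractions (G : BoundaryGraph n) : (H : BoundaryGraph n) → (H.E → G.E) → Prop
  | refl : Contractions G G id
  | step {H K : BoundaryGraph n} {ι : H.E → G.E} {κ : K.E → H.E} :
      Contractions G H ι → IsContraction H K κ → Contractions G K (ι ∘ κ)

/-- `S` is a section graph `σ(G)` of `G`: it arises from the star graph by replacing the black
vertices of degree greater than `3` by bipartite trees with trivalent black vertices, which gives a
graph `H`, and then contracting all black vertices of degree `2`. The maps `ι` and `κ` include the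
edges of the star graph, respectively of `S`, into those of `H`. -/
structure IsSection [NeZero n] (G S H : BoundaryGraph n) (ι : G.star.E → H.E) (κ : S.E → H.E) : Prop where
  splits : Splits G.star H ι
  contractions : Contractions H S κ
  trivalent : S.IsTrivalent

/-- The edge `e` of `G`, with endpoints `b` and `w`, and the edge `s` of the section graph
correspond to each other: `s` is (what has become of) the edge of the star graph that joins the
white vertex `b` to the face opposite to `w` across `b`, i.e. the corner of `b` that is not adjacent
to `e`. -/
def EdgesCorrespond [NeZero n] {G S H : BoundaryGraph n} (ι : G.star.E → H.E) (κ : S.E → H.E)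
    (e : G.E) (s : S.E) : Prop :=
  κ s = ι (Sum.inl (G.black e))

end BoundaryGraph

/-! ### Counting cycles -/

/-! A strand of the star graph is a strand of `G` pushed to its left. On the directed edge `toWhite
c`, a strand of `G` has the face of the corner `c` on its left. It keeps this face while it passes
the white vertex and leaves it at the corner `G.face c`, just as the star strand that enters the
black vertex of the face along the edge `c` leaves it along `G.face c`. Trivalence of `G` makes both
continue with the same next corner. On the boundary, the star strand starts at the corner `inr i` of
the source `i`, and it leaves by the corner `inr j` exactly where the strand of `G` leaves by the
leg `j + 1`; this is the shift of the strand permutation. `Follows` records this relation. It holds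
for the star graph and survives splits (`Follows.star`, `Follows.split`), while each step in a
contracted graph is a path in the graph before contraction (`Contractions.transGen`). Once there are
no closed loops, strands are numbered by their sources, which gives the bijection.

For minimality, the two passages of an edge of a split star graph belong to visits of the same face
of `G`, at different corners. A forbidden configuration therefore yields one strand of `G` with a
face on its left twice, or two strands with two visits of common faces in the same order, or two
edges met during one visit of each strand. The first two are excluded by
`IsMinimal.not_reaches_of_sameCycle_face` and `IsMinimal.not_parallel_faces`. For the third, a
weight `ρ` gives the passages of an edge `s` the positions `ρ s` and `-ρ s` and makes positions
increase along every visit, so two strands that traverse the same edges in opposite directions meet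
them in opposite orders.

The two exclusions are winding number arguments. Segments of strands are closed up inside common
faces. A medial strand crosses each edge with the black end on its left and the white end on its
right, so the winding numbers `P` around white and `Q` around black vertices differ along an edge by
the signed number of passages. They exist by `exists_potential`, where Euler characteristic `2`
enters. They vanish at both ends of a strand, so a nonzero value forces a crossing with a definite
sign, and this crossing completes a self-intersection or a parallel bigon of `G`.

Planarity of the section graph is a cycle count: contracting a vertex of degree `2` removes a
vertex, joins two others, deletes two edges and keeps the faces. Splits reverse this with the
colours exchanged. -/

theorem Equiv.Perm.SameCycle.map_eq {α X : Type*} {p : Equiv.Perm α} {h : α → X}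
    (hh : ∀ a, h (p a) = h a) {a b : α} (hab : p.SameCycle a b) : h a = h b := by
  obtain ⟨i, rfl⟩ := hab
  induction i using Int.induction_on with
  | zero => simp
  | succ i ih =>
    rw [ih, add_comm, zpow_add, zpow_one, Equiv.Perm.mul_apply, hh]
  | pred i ih =>
    rw [ih]
    have := hh ((p ^ (-(i : ℤ) - 1)) a)
    rw [← Equiv.Perm.mul_apply, ← zpow_one_add] at this
    rw [← this]
    congr 3
    ring

theorem Equiv.Perm.SameCycle.of_map {α β : Type*} {p : Equiv.Perm α} {q : Equiv.Perm β} {f : β → α}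
    (hf : ∀ b, p.SameCycle (f b) (f (q b))) {b b' : β} (h : q.SameCycle b b') :
    p.SameCycle (f b) (f b') := by
  have := h.map_eq (h := fun b => Quotient.mk (Equiv.Perm.SameCycle.setoid p) (f b))
    (fun b => Quotient.sound (hf b).symm)
  exact Quotient.exact this

/-- Two maps that are inverse to each other only up to cycles still induce a bijection of cycles, so
the underlying sets may have different sizes. -/
theorem numCycles_eq_of_maps {α β : Type} (p : Equiv.Perm α) (q : Equiv.Perm β) (f : β → α)
    (g : α → β) (hf : ∀ b, p.SameCycle (f b) (f (q b))) (hg : ∀ a, q.SameCycle (g a) (g (p a)))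
    (hgf : ∀ b, q.SameCycle (g (f b)) b) (hfg : ∀ a, p.SameCycle (f (g a)) a) :
    numCycles q = numCycles p := by
  refine Nat.card_congr
    { toFun := Quotient.map f fun _ _ h => Equiv.Perm.SameCycle.of_map hf h
      invFun := Quotient.map g fun _ _ h => Equiv.Perm.SameCycle.of_map hg h
      left_inv := ?_
      right_inv := ?_ }
  · rintro ⟨b⟩
    exact Quotient.sound (hgf b)
  · rintro ⟨a⟩
    exact Quotient.sound (hfg a)

theorem numCycles_sumCongr {α β : Type} [Finite α] [Finite β] (p : Equiv.Perm α)
    (q : Equiv.Perm β) :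
    numCycles (Equiv.sumCongr p q) = numCycles p + numCycles q := by
  unfold numCycles
  rw [← Nat.card_sum]
  let F : α ⊕ β → Quotient (Equiv.Perm.SameCycle.setoid p) ⊕
      Quotient (Equiv.Perm.SameCycle.setoid q) := Sum.map (Quotient.mk _) (Quotient.mk _)
  have hF : ∀ z, F (Equiv.sumCongr p q z) = F z := by
    rintro (a | b)
    · exact congrArg Sum.inl (Quotient.sound (Equiv.Perm.sameCycle_apply_left.2 (.refl _ _)))
    · exact congrArg Sum.inr (Quotient.sound (Equiv.Perm.sameCycle_apply_left.2 (.refl _ _)))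
  refine Nat.card_congr
    { toFun := Quotient.lift F fun _ _ h => Equiv.Perm.SameCycle.map_eq hF h
      invFun := Sum.elim
        (Quotient.map Sum.inl fun _ _ h => Equiv.Perm.SameCycle.of_map (fun a => by
          exact ⟨1, by simp⟩) h)
        (Quotient.map Sum.inr fun _ _ h => Equiv.Perm.SameCycle.of_map (fun a => by
          exact ⟨1, by simp⟩) h)
      left_inv := ?_
      right_inv := ?_ }
  · rintro ⟨a | b⟩ <;> rfl
  · rintro (⟨⟨a⟩⟩ | ⟨⟨b⟩⟩) <;> rfl

theorem numCycles_one (α : Type) : numCycles (1 : Equiv.Perm α) = Nat.card α := by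
  refine (Nat.card_congr (Equiv.ofBijective (Quotient.mk _) ⟨fun a b h => ?_, Quotient.mk_surjective⟩)).symm
  have h' : (1 : Equiv.Perm α).SameCycle a b := Quotient.exact h
  simpa using h'

theorem sameCycle_addRight_one {n : ℕ} (i j : ZMod n) :
    (Equiv.addRight (1 : ZMod n)).SameCycle i j := by
  have h : ∀ (k : ℕ), (Equiv.addRight (1 : ZMod n)).SameCycle i (i + k) := by
    intro k
    induction k with
    | zero => simpa using Equiv.Perm.SameCycle.refl _ _
    | succ k ih =>
      refine ih.trans ⟨1, ?_⟩
      simp [add_assoc]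
  obtain ⟨k, hk⟩ := ZMod.intCast_surjective (j - i)
  rcases Int.eq_nat_or_neg k with ⟨m, rfl | rfl⟩
  · have := h m
    rw [show (m : ZMod n) = j - i by simpa using hk] at this
    simpa using this
  · have h' : ∀ (k : ℕ), (Equiv.addRight (1 : ZMod n)).SameCycle (i - k) i := by
      intro k
      induction k with
      | zero => simpa using Equiv.Perm.SameCycle.refl _ _
      | succ k ih =>
        refine Equiv.Perm.SameCycle.trans ⟨1, ?_⟩ ih
        simp; ring
    have := h' m
    rw [show i - (m : ZMod n) = j by
      rw [sub_eq_add_neg, show -(m : ZMod n) = j - i by simpa using hk]; ring] at this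
    exact this.symm

theorem numCycles_eq_one {α : Type} [Nonempty α] (p : Equiv.Perm α) (h : ∀ a b, p.SameCycle a b) :
    numCycles p = 1 := by
  have : Subsingleton (Quotient (Equiv.Perm.SameCycle.setoid p)) :=
    ⟨by rintro ⟨a⟩ ⟨b⟩; exact Quotient.sound (h a b)⟩
  have : Nonempty (Quotient (Equiv.Perm.SameCycle.setoid p)) := ‹Nonempty α›.map (Quotient.mk _)
  exact Nat.card_of_subsingleton (Classical.arbitrary _)

/-- Constancy of invariant predicates is the form of connectedness that transports along
contractions. For the converse, the orbit of a point is itself an invariant predicate. -/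
theorem isPretransitive_closure_pair_iff {α : Type*} (p q : Equiv.Perm α) :
    MulAction.IsPretransitive (Subgroup.closure ({p, q} : Set (Equiv.Perm α))) α ↔
      ∀ f : α → Prop, (∀ a, f (p a) = f a) → (∀ a, f (q a) = f a) → ∀ a b, f a = f b := by
  constructor
  · intro h f hp hq a b
    obtain ⟨⟨g, hg⟩, rfl⟩ := h.exists_smul_eq a b
    have key : ∀ a, f (g a) = f a := by
      induction hg using Subgroup.closure_induction with
      | mem x hx =>
        rcases hx with rfl | rfl
        · exact hp
        · exact hq
      | one => intro a; rfl
      | mul x y _ _ hx hy => intro a; rw [Equiv.Perm.mul_apply, hx, hy]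
      | inv x _ hx => intro a; simpa using (hx (x⁻¹ a)).symm
    exact (key a).symm
  · intro h
    have hp : p ∈ Subgroup.closure ({p, q} : Set (Equiv.Perm α)) :=
      Subgroup.subset_closure (by simp)
    have hq : q ∈ Subgroup.closure ({p, q} : Set (Equiv.Perm α)) :=
      Subgroup.subset_closure (by simp)
    have key : ∀ r ∈ Subgroup.closure ({p, q} : Set (Equiv.Perm α)), ∀ a b : α,
        (∃ g ∈ Subgroup.closure ({p, q} : Set (Equiv.Perm α)), g a = r b) =
        (∃ g ∈ Subgroup.closure ({p, q} : Set (Equiv.Perm α)), g a = b) := by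
      intro r hr a b
      apply propext
      constructor
      · rintro ⟨g, hg, hb⟩
        exact ⟨r⁻¹ * g, mul_mem (inv_mem hr) hg, by simp [hb]⟩
      · rintro ⟨g, hg, hb⟩
        exact ⟨r * g, mul_mem hr hg, by simp [hb]⟩
    refine ⟨fun a b => ?_⟩
    have := h (fun c => ∃ g ∈ Subgroup.closure ({p, q} : Set (Equiv.Perm α)), g a = c)
      (key p hp a) (key q hq a) a b
    obtain ⟨g, hg, hb⟩ := this.mp ⟨1, one_mem _, rfl⟩
    exact ⟨⟨g, hg⟩, hb⟩

/-! ### Merging two cycles -/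

/-- `τ'` is, along the inclusion `ι`, the permutation `mergeCycles τ x y`, spelled out. -/
def IsMerge {α β : Type*} (τ : Equiv.Perm α) (x y : α) (ι : β → α) (τ' : Equiv.Perm β) : Prop :=
  ∀ b, (τ (ι b) = x ∧ τ x ≠ x ∧ τ y ≠ y ∧ ι (τ' b) = τ y) ∨
    (τ (ι b) = x ∧ τ x ≠ x ∧ τ y = y ∧ ι (τ' b) = τ x) ∨
    (τ (ι b) = y ∧ τ y ≠ y ∧ τ x ≠ x ∧ ι (τ' b) = τ x) ∨
    (τ (ι b) = y ∧ τ y ≠ y ∧ τ x = x ∧ ι (τ' b) = τ y) ∨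
    (τ (ι b) ≠ x ∧ τ (ι b) ≠ y ∧ ι (τ' b) = τ (ι b))

theorem removePoint_apply_of_ne {α : Type} (p : Equiv.Perm α) {x a : α} (ha : a ≠ x) :
    (p a = x → BoundaryGraph.removePoint p x a = p x) ∧ (p a ≠ x → BoundaryGraph.removePoint p x a = p a) := by
  classical
  unfold BoundaryGraph.removePoint
  constructor
  · intro h
    rw [Equiv.Perm.mul_apply, h, Equiv.swap_apply_left]
  · intro h
    rw [Equiv.Perm.mul_apply, Equiv.swap_apply_of_ne_of_ne h]
    exact fun h' => ha (p.injective h')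

/-- The five alternatives record whether the image would be `x`, `y` or neither, and whether the
other deleted point is alone in its cycle. In the latter case the rotation resumes in the cycle it
came from. -/
theorem isMerge_of_mergeCycles {α : Type} {β : Type*} {τ : Equiv.Perm α} {x y : α} {ι : β → α}
    {τ' : Equiv.Perm β} (hxy : ¬ τ.SameCycle x y) (hι : Set.range ι = {x, y}ᶜ)
    (h : ∀ b, ι (τ' b) = BoundaryGraph.mergeCycles τ x y (ι b)) : IsMerge τ x y ι τ' := by
  classical
  intro b
  have hne : x ≠ y := fun h => hxy (h ▸ .refl _ _)
  have hb : ι b ∈ ({x, y}ᶜ : Set α) := hι ▸ Set.mem_range_self b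
  obtain ⟨hbx, hby⟩ : ι b ≠ x ∧ ι b ≠ y := by simpa using hb
  rw [h b]
  have hτxy : τ x ≠ y := fun h => hxy ⟨1, by simpa using h⟩
  have hτyx : τ y ≠ x := fun h => hxy (Equiv.Perm.SameCycle.symm ⟨1, by simpa using h⟩)
  set a := ι b
  set t := τ * Equiv.swap x y with ht
  have htx : t x = τ y := by simp [ht]
  have hty : t y = τ x := by simp [ht]
  have hta : t a = τ a := by
    rw [ht, Equiv.Perm.mul_apply, Equiv.swap_apply_of_ne_of_ne hbx hby]
  have hm : BoundaryGraph.mergeCycles τ x y =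
      BoundaryGraph.removePoint (BoundaryGraph.removePoint t x) y := by
    unfold BoundaryGraph.mergeCycles
    rw [ht]
  rw [hm]
  obtain ⟨h1, h2⟩ := removePoint_apply_of_ne t hbx
  obtain ⟨h3, h4⟩ := removePoint_apply_of_ne t hne.symm
  obtain ⟨h5, h6⟩ := removePoint_apply_of_ne (BoundaryGraph.removePoint t x) hby
  rw [htx, hta] at h1
  rw [hta] at h2
  rw [hty, htx] at h3
  rw [hty] at h4
  by_cases hax : τ a = x
  · have hxx : τ x ≠ x := fun h => hbx (τ.injective (hax.trans h.symm))
    rw [h1 hax, h4 hxx] at h5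
    rw [h1 hax] at h6
    by_cases hyy : τ y = y
    · exact Or.inr (Or.inl ⟨hax, hxx, hyy, h5 hyy⟩)
    · exact Or.inl ⟨hax, hxx, hyy, h6 hyy⟩
  · rw [h2 hax] at h5 h6
    by_cases hay : τ a = y
    · have hyy : τ y ≠ y := fun h => hby (τ.injective (hay.trans h.symm))
      by_cases hxx : τ x = x
      · exact Or.inr (Or.inr (Or.inr (Or.inl ⟨hay, hyy, hxx, (h5 hay).trans (h3 hxx)⟩)))
      · exact Or.inr (Or.inr (Or.inl ⟨hay, hyy, hxx, (h5 hay).trans (h4 hxx)⟩))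
    · exact Or.inr (Or.inr (Or.inr (Or.inr ⟨hax, hay, h6 hay⟩)))

section Merge

variable {α β : Type} {σ τ : Equiv.Perm α} {σ' τ' : Equiv.Perm β} {x y : α} {ι : β → α}

/-- The two cycles that are merged have become a single cycle. -/
theorem IsMerge.sameCycle (hm : IsMerge τ x y ι τ') (hinj : Function.Injective ι)
    (hι : Set.range ι = {x, y}ᶜ) (hxy : ¬ τ.SameCycle x y) (hfin : Finite α) {b b' : β}
    (hb : τ.SameCycle x (ι b) ∨ τ.SameCycle y (ι b))
    (hb' : τ.SameCycle x (ι b') ∨ τ.SameCycle y (ι b')) : τ'.SameCycle b b' := by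
  classical
  have hτxy : τ x ≠ y := fun h => hxy ⟨1, by simpa using h⟩
  have hτyx : τ y ≠ x := fun h => hxy (Equiv.Perm.SameCycle.symm ⟨1, by simpa using h⟩)
  have hιne : ∀ b, ι b ≠ x ∧ ι b ≠ y := fun b => by
    have hb : ι b ∈ ({x, y}ᶜ : Set α) := hι ▸ Set.mem_range_self b
    simpa using hb
  have hex : ∀ a, a ≠ x → a ≠ y → ∃ b, ι b = a := fun a h1 h2 => by
    have : a ∈ Set.range ι := by rw [hι]; simp [h1, h2]
    exact this
  have hne' : τ x ≠ x ∨ τ y ≠ y := by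
    by_contra hcon
    push Not at hcon
    rcases hb with hb | hb
    · exact (hιne b).1 ((hb.map_eq (h := fun a => (a = x : Prop)) (fun a => propext
        ⟨fun h => τ.injective (h.trans hcon.1.symm), fun h => h ▸ hcon.1⟩)).mp rfl)
    · exact (hιne b).2 ((hb.map_eq (h := fun a => (a = y : Prop)) (fun a => propext
        ⟨fun h => τ.injective (h.trans hcon.2.symm), fun h => h ▸ hcon.2⟩)).mp rfl)
  -- `rx` is the first surviving point after `x`. If `x` is alone in its cycle, nothing of that
  -- cycle survives, and a point of the other cycle stands in.
  obtain ⟨rx, hrx⟩ : ∃ rx, ι rx = if τ x = x then τ y else τ x := by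
    split_ifs with h
    · exact hex _ hτyx (hne'.resolve_left (not_not.2 h))
    · exact hex _ h hτxy
  obtain ⟨ry, hry⟩ : ∃ ry, ι ry = if τ y = y then τ x else τ y := by
    split_ifs with h
    · exact hex _ (hne'.resolve_right (not_not.2 h)) hτxy
    · exact hex _ hτyx h
  have stepX : ∀ i : ℕ, ∀ b, ι b = (τ ^ i) x → τ'.SameCycle rx b := by
    intro i
    induction i with
    | zero => intro b hb; exact absurd hb (hιne b).1
    | succ i ih =>
      intro b hb
      rw [pow_succ', Equiv.Perm.mul_apply] at hb
      have hzy : (τ ^ i) x ≠ y := fun h => hxy ⟨i, by simpa using h⟩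
      by_cases hzx : (τ ^ i) x = x
      · rw [hzx] at hb
        have hxx : τ x ≠ x := hb ▸ (hιne b).1
        rw [if_neg hxx, ← hb] at hrx
        rw [hinj hrx]
      · obtain ⟨c, hc⟩ := hex _ hzx hzy
        rw [← hc] at hb
        have h1 := ih c hc
        rcases hm c with h | h | h | h | h
        · exact absurd (hb.trans h.1) (hιne b).1
        · exact absurd (hb.trans h.1) (hιne b).1
        · exact absurd (hb.trans h.1) (hιne b).2
        · exact absurd (hb.trans h.1) (hιne b).2
        · rw [hinj (hb.trans h.2.2.symm)]
          exact Equiv.Perm.sameCycle_apply_right.2 h1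
  have stepY : ∀ i : ℕ, ∀ b, ι b = (τ ^ i) y → τ'.SameCycle ry b := by
    intro i
    induction i with
    | zero => intro b hb; exact absurd hb (hιne b).2
    | succ i ih =>
      intro b hb
      rw [pow_succ', Equiv.Perm.mul_apply] at hb
      have hzy : (τ ^ i) y ≠ x := fun h => hxy (Equiv.Perm.SameCycle.symm ⟨i, by simpa using h⟩)
      by_cases hzx : (τ ^ i) y = y
      · rw [hzx] at hb
        have hxx : τ y ≠ y := hb ▸ (hιne b).2
        rw [if_neg hxx, ← hb] at hry
        rw [hinj hry]
      · obtain ⟨c, hc⟩ := hex _ hzy hzx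
        rw [← hc] at hb
        have h1 := ih c hc
        rcases hm c with h | h | h | h | h
        · exact absurd (hb.trans h.1) (hιne b).1
        · exact absurd (hb.trans h.1) (hιne b).1
        · exact absurd (hb.trans h.1) (hιne b).2
        · exact absurd (hb.trans h.1) (hιne b).2
        · rw [hinj (hb.trans h.2.2.symm)]
          exact Equiv.Perm.sameCycle_apply_right.2 h1
  have hX : ∀ b, τ.SameCycle x (ι b) → τ'.SameCycle rx b := fun b hb => by
    obtain ⟨i, hi⟩ := hb.exists_nat_pow_eq
    exact stepX i b hi.symm
  have hY : ∀ b, τ.SameCycle y (ι b) → τ'.SameCycle ry b := fun b hb => by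
    obtain ⟨i, hi⟩ := hb.exists_nat_pow_eq
    exact stepY i b hi.symm
  -- The predecessor of `x` is the point at which the merged cycle passes from one remnant to the
  -- other.
  have hxyr : τ'.SameCycle rx ry := by
    by_cases hxx : τ x = x
    · have hyy := hne'.resolve_left (not_not.2 hxx)
      rw [if_pos hxx] at hrx
      rw [if_neg hyy] at hry
      rw [hinj (hrx.trans hry.symm)]
    · have h1 : τ⁻¹ x ≠ x := fun h => hxx (by rw [Equiv.Perm.inv_eq_iff_eq] at h; exact h.symm)
      have h2 : τ⁻¹ x ≠ y := fun h => hτyx (by rw [Equiv.Perm.inv_eq_iff_eq] at h; exact h.symm)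
      obtain ⟨c, hc⟩ := hex _ h1 h2
      have hcx : τ (ι c) = x := by rw [hc]; simp
      have h3 : τ'.SameCycle rx c := hX c ⟨-1, by rw [hc]; simp⟩
      have h4 : τ' c = ry := by
        apply hinj
        rw [hry]
        rcases hm c with h | h | h | h | h
        · rw [if_neg h.2.2.1, h.2.2.2]
        · rw [if_pos h.2.2.1, h.2.2.2]
        · exact absurd (h.1.symm.trans hcx) (fun h => hxy (h ▸ .refl _ _))
        · exact absurd (h.1.symm.trans hcx) (fun h => hxy (h ▸ .refl _ _))
        · exact absurd hcx h.1
      rw [← h4]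
      exact Equiv.Perm.sameCycle_apply_right.2 h3
  have all : ∀ b, (τ.SameCycle x (ι b) ∨ τ.SameCycle y (ι b)) → τ'.SameCycle rx b := fun b hb =>
    hb.elim (hX b) (fun h => hxyr.trans (hY b h))
  exact (all b hb).symm.trans (all b' hb')

end Merge

theorem numCycles_inv {α : Type} (p : Equiv.Perm α) : numCycles p⁻¹ = numCycles p :=
  numCycles_eq_of_maps p p⁻¹ id id (fun b => ⟨-1, by simp⟩) (fun a => ⟨-1, by simp⟩)
    (fun _ => .refl _ _) (fun _ => .refl _ _)

theorem numCycles_mul_comm {α : Type} (p q : Equiv.Perm α) :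
    numCycles (p * q) = numCycles (q * p) :=
  numCycles_eq_of_maps (q * p) (p * q) q p (fun b => ⟨1, by simp⟩) (fun a => ⟨1, by simp⟩)
    (fun b => Equiv.Perm.SameCycle.symm ⟨1, by simp⟩)
    (fun b => Equiv.Perm.SameCycle.symm ⟨1, by simp⟩)

section Merge

variable {α β : Type} {σ τ : Equiv.Perm α} {σ' τ' : Equiv.Perm β} {x y : α} {ι : β → α}

theorem exists_inverse_on_compl [Nonempty β] (hι : Set.range ι = {x, y}ᶜ) :
    ∃ r : α → β, ∀ a, a ≠ x → a ≠ y → ι (r a) = a := by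
  have : ∀ a, ∃ b, a ≠ x → a ≠ y → ι b = a := by
    intro a
    by_cases h : a ∈ Set.range ι
    · obtain ⟨b, hb⟩ := h
      exact ⟨b, fun _ _ => hb⟩
    · refine ⟨Classical.arbitrary β, fun h1 h2 => absurd ?_ h⟩
      rw [hι]; simp [h1, h2]
  choose r hr using this
  exact ⟨r, hr⟩

theorem ne_of_range_eq (hι : Set.range ι = {x, y}ᶜ) (b : β) : ι b ≠ x ∧ ι b ≠ y := by
  have hb : ι b ∈ ({x, y}ᶜ : Set α) := hι ▸ Set.mem_range_self b
  simpa using hb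

theorem numCycles_eq_add_one_of_two_cycle [Finite α] [Nonempty β] (hinj : Function.Injective ι)
    (hι : Set.range ι = {x, y}ᶜ) (hσx : σ x = y) (hσy : σ y = x)
    (hσ : ∀ b, ι (σ' b) = σ (ι b)) : numCycles σ = numCycles σ' + 1 := by
  classical
  have := Finite.of_injective ι hinj
  obtain ⟨r, hr⟩ := exists_inverse_on_compl hι
  have hιne := ne_of_range_eq hι
  have h1 : numCycles (1 : Equiv.Perm Unit) = 1 := by simp [numCycles_one]
  rw [← h1, ← numCycles_sumCongr]
  symm
  refine numCycles_eq_of_maps _ _ (Sum.elim ι fun _ => x)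
    (fun a => if a = x ∨ a = y then Sum.inr () else Sum.inl (r a)) ?_ ?_ ?_ ?_
  · rintro (b | u)
    · exact ⟨1, by simp [hσ]⟩
    · exact .refl _ _
  · intro a
    by_cases ha : a = x ∨ a = y
    · have ha' : σ a = x ∨ σ a = y := by
        rcases ha with rfl | rfl
        · exact Or.inr hσx
        · exact Or.inl hσy
      simp only [if_pos ha, if_pos ha']
      exact .refl _ _
    · have ha' : ¬ (σ a = x ∨ σ a = y) := by
        rintro (h | h)
        · exact ha (Or.inr (σ.injective (h.trans hσy.symm)))
        · exact ha (Or.inl (σ.injective (h.trans hσx.symm)))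
      simp only [if_neg ha, if_neg ha']
      push Not at ha ha'
      refine ⟨1, ?_⟩
      simp only [zpow_one, Equiv.sumCongr_apply, Sum.map_inl, Sum.inl.injEq]
      apply hinj
      rw [hσ, hr _ ha.1 ha.2, hr _ ha'.1 ha'.2]
  · rintro (b | u)
    · have hb := hιne b
      simp only [Sum.elim_inl, hb.1, hb.2, or_self, if_false]
      rw [hinj (hr (ι b) hb.1 hb.2)]
    · simp only [Sum.elim_inr, true_or, if_true]
      exact .refl _ _
  · intro a
    by_cases ha : a = x ∨ a = y
    · simp only [if_pos ha, Sum.elim_inr]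
      rcases ha with rfl | rfl
      · exact .refl _ _
      · exact ⟨1, by simpa using hσx⟩
    · simp only [if_neg ha, Sum.elim_inl]
      push Not at ha
      rw [hr _ ha.1 ha.2]

theorem exists_mem_merged [Finite α] (hι : Set.range ι = {x, y}ᶜ) (hxy : ¬ τ.SameCycle x y)
    (hns : τ x ≠ x ∨ τ y ≠ y) : ∃ b, τ.SameCycle x (ι b) ∨ τ.SameCycle y (ι b) := by
  have hτxy : τ x ≠ y := fun h => hxy ⟨1, by simpa using h⟩
  have hτyx : τ y ≠ x := fun h => hxy (Equiv.Perm.SameCycle.symm ⟨1, by simpa using h⟩)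
  have hex : ∀ a, a ≠ x → a ≠ y → ∃ b, ι b = a := fun a h1 h2 => by
    have : a ∈ Set.range ι := by rw [hι]; simp [h1, h2]
    exact this
  rcases hns with h | h
  · obtain ⟨b, hb⟩ := hex _ h hτxy
    exact ⟨b, Or.inl ⟨1, by simp [hb]⟩⟩
  · obtain ⟨b, hb⟩ := hex _ hτyx h
    exact ⟨b, Or.inr ⟨1, by simp [hb]⟩⟩

theorem IsMerge.apply_of_not_mem (hm : IsMerge τ x y ι τ') {b : β} (hx : ¬ τ.SameCycle x (ι b))
    (hy : ¬ τ.SameCycle y (ι b)) : ι (τ' b) = τ (ι b) := by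
  have h1 : τ (ι b) ≠ x := fun h => hx (Equiv.Perm.SameCycle.symm ⟨1, by simpa using h⟩)
  have h2 : τ (ι b) ≠ y := fun h => hy (Equiv.Perm.SameCycle.symm ⟨1, by simpa using h⟩)
  rcases hm b with h | h | h | h | h
  · exact absurd h.1 h1
  · exact absurd h.1 h1
  · exact absurd h.1 h2
  · exact absurd h.1 h2
  · exact h.2.2

theorem IsMerge.apply_mem (hm : IsMerge τ x y ι τ') {b : β}
    (hb : τ.SameCycle x (ι b) ∨ τ.SameCycle y (ι b)) :
    τ.SameCycle x (ι (τ' b)) ∨ τ.SameCycle y (ι (τ' b)) := by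
  rcases hm b with h | h | h | h | h
  · rw [h.2.2.2]; exact Or.inr ⟨1, by simp⟩
  · rw [h.2.2.2]; exact Or.inl ⟨1, by simp⟩
  · rw [h.2.2.2]; exact Or.inl ⟨1, by simp⟩
  · rw [h.2.2.2]; exact Or.inr ⟨1, by simp⟩
  · rw [h.2.2]
    exact hb.imp Equiv.Perm.sameCycle_apply_right.2 Equiv.Perm.sameCycle_apply_right.2

theorem IsMerge.numCycles_eq_add_one [Finite α] [Nonempty β] (hm : IsMerge τ x y ι τ')
    (hinj : Function.Injective ι) (hι : Set.range ι = {x, y}ᶜ) (hxy : ¬ τ.SameCycle x y)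
    (hns : τ x ≠ x ∨ τ y ≠ y) : numCycles τ = numCycles τ' + 1 := by
  classical
  have := Finite.of_injective ι hinj
  obtain ⟨r, hr⟩ := exists_inverse_on_compl hι
  have hιne := ne_of_range_eq hι
  obtain ⟨b₀, hb₀⟩ := exists_mem_merged hι hxy hns
  have hone := fun {b b'} => hm.sameCycle (b := b) (b' := b') hinj hι hxy inferInstance
  have h1 : numCycles (1 : Equiv.Perm Unit) = 1 := by simp [numCycles_one]
  rw [← h1, ← numCycles_sumCongr]
  symm
  -- The merged cycle stands for the cycle of `x`, and the extra point for the cycle of `y`.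
  refine numCycles_eq_of_maps _ _
    (Sum.elim (fun b => if τ.SameCycle x (ι b) ∨ τ.SameCycle y (ι b) then x else ι b) fun _ => y)
    (fun a => if τ.SameCycle y a then Sum.inr () else
      if τ.SameCycle x a then Sum.inl b₀ else Sum.inl (r a)) ?_ ?_ ?_ ?_
  · rintro (b | u)
    · by_cases hb : τ.SameCycle x (ι b) ∨ τ.SameCycle y (ι b)
      · have hb' := hm.apply_mem hb
        simp only [Equiv.sumCongr_apply, Sum.map_inl, Sum.elim_inl, if_pos hb, if_pos hb']
        exact .refl _ _
      · have hb2 := hb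
        push Not at hb2
        have h2 := hm.apply_of_not_mem hb2.1 hb2.2
        have hb' : ¬ (τ.SameCycle x (ι (τ' b)) ∨ τ.SameCycle y (ι (τ' b))) := by
          rw [h2, Equiv.Perm.sameCycle_apply_right, Equiv.Perm.sameCycle_apply_right]
          exact hb
        simp only [Equiv.sumCongr_apply, Sum.map_inl, Sum.elim_inl, if_neg hb, if_neg hb']
        exact ⟨1, by simp [h2]⟩
    · exact .refl _ _
  · intro a
    simp only [Equiv.Perm.sameCycle_apply_right]
    split_ifs with h1 h2
    · exact .refl _ _
    · exact .refl _ _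
    · have hax : a ≠ x := fun h => h2 (h ▸ .refl _ _)
      have hay : a ≠ y := fun h => h1 (h ▸ .refl _ _)
      have hax' : τ a ≠ x := fun h => h2 (Equiv.Perm.SameCycle.symm ⟨1, by simpa using h⟩)
      have hay' : τ a ≠ y := fun h => h1 (Equiv.Perm.SameCycle.symm ⟨1, by simpa using h⟩)
      refine ⟨1, ?_⟩
      simp only [zpow_one, Equiv.sumCongr_apply, Sum.map_inl, Sum.inl.injEq]
      apply hinj
      rw [hr _ hax' hay', hm.apply_of_not_mem, hr _ hax hay] <;> rwa [hr _ hax hay]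
  · rintro (b | u)
    · by_cases hb : τ.SameCycle x (ι b) ∨ τ.SameCycle y (ι b)
      · simp only [Sum.elim_inl, if_pos hb, if_neg (fun h => hxy (Equiv.Perm.SameCycle.symm h)),
          Equiv.Perm.SameCycle.refl, if_true]
        exact Equiv.Perm.SameCycle.of_map (fun b => ⟨1, by simp⟩) (hone hb₀ hb)
      · have hb2 := hb
        push Not at hb2
        have hb3 := hιne b
        simp only [Sum.elim_inl, if_neg hb, if_neg hb2.1, if_neg hb2.2]
        rw [hinj (hr (ι b) hb3.1 hb3.2)]
    · simp only [Sum.elim_inr, Equiv.Perm.SameCycle.refl, if_true]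
  · intro a
    split_ifs with h1 h2
    · exact h1
    · simpa only [Sum.elim_inl, if_pos hb₀] using h2
    · have hax : a ≠ x := fun h => h2 (h ▸ .refl _ _)
      have hay : a ≠ y := fun h => h1 (h ▸ .refl _ _)
      have h3 : ¬ (τ.SameCycle x (ι (r a)) ∨ τ.SameCycle y (ι (r a))) := by
        rw [hr _ hax hay]
        exact fun h => h.elim h2 h1
      simp only [Sum.elim_inl, if_neg h3]
      rw [hr _ hax hay]

/-- `σ' * τ'` is the first-return map of `σ * τ` to the complement of `{x, y}`, and by `hns` no
cycle of `σ * τ` is contained in `{x, y}`. Geometrically, contracting a vertex of degree `2` keeps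
the faces. The retraction `r` sends `x` and `y` to the next surviving point. -/
theorem IsMerge.numCycles_mul_eq [Finite α] [Nonempty β] (hm : IsMerge τ x y ι τ')
    (hinj : Function.Injective ι) (hι : Set.range ι = {x, y}ᶜ) (hxy : ¬ τ.SameCycle x y)
    (hns : τ x ≠ x ∨ τ y ≠ y) (hσx : σ x = y) (hσy : σ y = x)
    (hσ : ∀ b, ι (σ' b) = σ (ι b)) : numCycles (σ * τ) = numCycles (σ' * τ') := by
  classical
  obtain ⟨r₀, hr₀⟩ := exists_inverse_on_compl hι
  have hιne := ne_of_range_eq hι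
  have hτxy : τ x ≠ y := fun h => hxy ⟨1, by simpa using h⟩
  have hτyx : τ y ≠ x := fun h => hxy (Equiv.Perm.SameCycle.symm ⟨1, by simpa using h⟩)
  have hne : x ≠ y := fun h => hxy (h ▸ .refl _ _)
  have hσne : ∀ a, a ≠ x → a ≠ y → σ a ≠ x ∧ σ a ≠ y := fun a h1 h2 =>
    ⟨fun h => h2 (σ.injective (h.trans hσy.symm)), fun h => h1 (σ.injective (h.trans hσx.symm))⟩
  obtain ⟨bx, hbx⟩ : ∃ bx, ι bx = if τ x = x then σ (τ y) else σ (τ x) := by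
    split_ifs with h
    · have := hσne _ hτyx (hns.resolve_left (not_not.2 h))
      exact ⟨_, hr₀ _ this.1 this.2⟩
    · have := hσne _ h hτxy
      exact ⟨_, hr₀ _ this.1 this.2⟩
  obtain ⟨b_y, hby⟩ : ∃ b_y, ι b_y = if τ y = y then σ (τ x) else σ (τ y) := by
    split_ifs with h
    · have := hσne _ (hns.resolve_right (not_not.2 h)) hτxy
      exact ⟨_, hr₀ _ this.1 this.2⟩
    · have := hσne _ hτyx h
      exact ⟨_, hr₀ _ this.1 this.2⟩
  let r : α → β := fun a => if a = x then bx else if a = y then b_y else r₀ a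
  have rx : r x = bx := by simp [r]
  have ry : r y = b_y := by simp [r, hne.symm]
  have rι : ∀ b, r (ι b) = b := fun b => by
    have := hιne b
    simp only [r, if_neg this.1, if_neg this.2]
    exact hinj (hr₀ _ this.1 this.2)
  have rr : ∀ a b, ι b = a → r a = b := fun a b h => by rw [← h, rι]
  have hstep : ∀ b, r ((σ * τ) (ι b)) = (σ' * τ') b := by
    intro b
    simp only [Equiv.Perm.mul_apply]
    rcases hm b with h | h | h | h | h
    · rw [h.1, hσx, ry]
      apply hinj
      rw [hby, if_neg h.2.2.1, hσ, h.2.2.2]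
    · rw [h.1, hσx, ry]
      apply hinj
      rw [hby, if_pos h.2.2.1, hσ, h.2.2.2]
    · rw [h.1, hσy, rx]
      apply hinj
      rw [hbx, if_neg h.2.2.1, hσ, h.2.2.2]
    · rw [h.1, hσy, rx]
      apply hinj
      rw [hbx, if_pos h.2.2.1, hσ, h.2.2.2]
    · exact rr _ _ (by rw [hσ, h.2.2])
  have hpx : (σ * τ) x = if τ x = x then y else ι bx := by
    split_ifs with h
    · simp [h, hσx]
    · simp [hbx, h]
  have hpy : (σ * τ) y = if τ y = y then x else ι b_y := by
    split_ifs with h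
    · simp [h, hσy]
    · simp [hby, h]
  have hx1 : (σ * τ).SameCycle (ι bx) x := by
    refine Equiv.Perm.SameCycle.symm ?_
    by_cases h : τ x = x
    · have hy := hns.resolve_left (not_not.2 h)
      rw [if_pos h] at hbx hpx
      exact ⟨2, by rw [zpow_two, Equiv.Perm.mul_apply, hpx]; simp [hbx]⟩
    · rw [if_neg h] at hpx
      exact ⟨1, by simpa using hpx⟩
  have hy1 : (σ * τ).SameCycle (ι b_y) y := by
    refine Equiv.Perm.SameCycle.symm ?_
    by_cases h : τ y = y
    · have hy := hns.resolve_right (not_not.2 h)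
      rw [if_pos h] at hby hpy
      exact ⟨2, by rw [zpow_two, Equiv.Perm.mul_apply, hpy]; simp [hby]⟩
    · rw [if_neg h] at hpy
      exact ⟨1, by simpa using hpy⟩
  have hιr : ∀ a, (σ * τ).SameCycle (ι (r a)) a := by
    intro a
    by_cases hax : a = x
    · rw [hax, rx]; exact hx1
    by_cases hay : a = y
    · rw [hay, ry]; exact hy1
    simp only [r, if_neg hax, if_neg hay]
    rw [hr₀ _ hax hay]
  symm
  refine numCycles_eq_of_maps _ _ ι r ?_ ?_ (fun b => by rw [rι]) hιr
  · intro b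
    rw [← hstep]
    exact Equiv.Perm.SameCycle.symm ((hιr _).trans (Equiv.Perm.SameCycle.symm ⟨1, by simp⟩))
  · intro a
    by_cases hax : a = x
    · rw [hax, hpx, rx]
      split_ifs with h
      · rw [ry]
        rw [if_pos h] at hbx
        rw [if_neg (hns.resolve_left (not_not.2 h))] at hby
        rw [hinj (hbx.trans hby.symm)]
      · rw [rι]
    by_cases hay : a = y
    · rw [hay, hpy, ry]
      split_ifs with h
      · rw [rx]
        rw [if_pos h] at hby
        rw [if_neg (hns.resolve_right (not_not.2 h))] at hbx
        rw [hinj (hbx.trans hby.symm)]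
      · rw [rι]
    · obtain ⟨b, rfl⟩ : ∃ b, ι b = a := ⟨_, hr₀ _ hax hay⟩
      rw [hstep, rι]
      exact ⟨1, by simp⟩

theorem IsMerge.connected_of_connected [Finite α] (hm : IsMerge τ x y ι τ')
    (hinj : Function.Injective ι) (hι : Set.range ι = {x, y}ᶜ) (hxy : ¬ τ.SameCycle x y)
    (hns : τ x ≠ x ∨ τ y ≠ y) (hσx : σ x = y) (hσy : σ y = x)
    (hσ : ∀ b, ι (σ' b) = σ (ι b))
    (h : ∀ f : α → Prop, (∀ a, f (τ a) = f a) → (∀ a, f (σ a) = f a) → ∀ a b, f a = f b)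
    (f : β → Prop) (hτf : ∀ b, f (τ' b) = f b) (hσf : ∀ b, f (σ' b) = f b) (b b' : β) :
    f b = f b' := by
  classical
  have : Nonempty β := ⟨b⟩
  obtain ⟨r, hr⟩ := exists_inverse_on_compl hι
  have hιne := ne_of_range_eq hι
  obtain ⟨b₀, hb₀⟩ := exists_mem_merged hι hxy hns
  have rι : ∀ b, r (ι b) = b := fun b => hinj (hr _ (hιne b).1 (hιne b).2)
  -- The predicate extends to the deleted points because it is constant on the merged cycle.
  let F : α → Prop := fun a => if τ.SameCycle x a ∨ τ.SameCycle y a then f b₀ else f (r a)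
  have hFx : F x = f b₀ := if_pos (Or.inl (.refl _ _))
  have hFy : F y = f b₀ := if_pos (Or.inr (.refl _ _))
  have hF : ∀ b, F (ι b) = f b := by
    intro b
    simp only [F]
    split_ifs with hb
    · exact (hm.sameCycle hinj hι hxy inferInstance hb₀ hb).map_eq hτf
    · rw [rι]
  rw [← hF b, ← hF b']
  refine h F ?_ ?_ _ _
  · intro a
    simp only [F, Equiv.Perm.sameCycle_apply_right]
    split_ifs with ha
    · rfl
    · push Not at ha
      have hax : a ≠ x := fun h => ha.1 (h ▸ .refl _ _)
      have hay : a ≠ y := fun h => ha.2 (h ▸ .refl _ _)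
      rw [← hr a hax hay] at ha ⊢
      rw [← hm.apply_of_not_mem ha.1 ha.2, rι, rι, hτf]
  · intro a
    by_cases hax : a = x
    · rw [hax, hσx, hFx, hFy]
    by_cases hay : a = y
    · rw [hay, hσy, hFx, hFy]
    obtain ⟨b, rfl⟩ : ∃ b, ι b = a := ⟨_, hr _ hax hay⟩
    rw [← hσ, hF, hF, hσf]

theorem IsMerge.connected_of_connected' (hm : IsMerge τ x y ι τ') [Nonempty β]
    (hι : Set.range ι = {x, y}ᶜ) (hxy : ¬ τ.SameCycle x y)
    (hns : τ x ≠ x ∨ τ y ≠ y) (hσx : σ x = y)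
    (hσ : ∀ b, ι (σ' b) = σ (ι b))
    (h : ∀ f : β → Prop, (∀ a, f (τ' a) = f a) → (∀ a, f (σ' a) = f a) → ∀ a b, f a = f b)
    (f : α → Prop) (hτf : ∀ b, f (τ b) = f b) (hσf : ∀ b, f (σ b) = f b) (a a' : α) :
    f a = f a' := by
  classical
  obtain ⟨r, hr⟩ := exists_inverse_on_compl hι
  have hτxy : τ x ≠ y := fun h => hxy ⟨1, by simpa using h⟩
  have hτyx : τ y ≠ x := fun h => hxy (Equiv.Perm.SameCycle.symm ⟨1, by simpa using h⟩)
  have hfxy : f x = f y := by rw [← hσx, hσf]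
  have hall := h (fun b => f (ι b)) (fun b => by
    rcases hm b with h | h | h | h | h
    · rw [h.2.2.2, hτf, ← hfxy, ← h.1, hτf]
    · rw [h.2.2.2, hτf, ← h.1, hτf]
    · rw [h.2.2.2, hτf, hfxy, ← h.1, hτf]
    · rw [h.2.2.2, hτf, ← h.1, hτf]
    · rw [h.2.2, hτf]) (fun b => by rw [hσ, hσf])
  obtain ⟨b₀, hb₀⟩ : ∃ b, f (ι b) = f x := by
    rcases hns with h | h
    · exact ⟨r (τ x), by rw [hr _ h hτxy, hτf]⟩
    · exact ⟨r (τ y), by rw [hr _ hτyx h, hτf, hfxy]⟩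
  have key : ∀ a, f a = f x := by
    intro a
    by_cases hax : a = x
    · rw [hax]
    by_cases hay : a = y
    · rw [hay, hfxy]
    rw [← hr a hax hay, ← hb₀]
    exact hall _ _
  rw [key, key a']

end Merge

theorem range_sumMap_id {α β γ : Type*} {ι : β → α} {x y : α} (hι : Set.range ι = {x, y}ᶜ) :
    Set.range (Sum.map ι (id : γ → γ)) = {Sum.inl x, Sum.inl y}ᶜ := by
  ext (a | c)
  · have : a ∈ Set.range ι ↔ a ∈ ({x, y}ᶜ : Set α) := by rw [hι]
    simpa using this
  · simp

theorem IsMerge.sumCongr {α β γ : Type*} {τ : Equiv.Perm α} {x y : α} {ι : β → α}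
    {τ' : Equiv.Perm β} (hm : IsMerge τ x y ι τ') (ρ : Equiv.Perm γ) :
    IsMerge (Equiv.sumCongr τ ρ) (Sum.inl x) (Sum.inl y) (Sum.map ι id)
      (Equiv.sumCongr τ' ρ) := by
  rintro (b | c)
  · simpa using hm b
  · simp

theorem not_sameCycle_sumCongr {α γ : Type*} {τ : Equiv.Perm α} {x y : α}
    (h : ¬ τ.SameCycle x y) (ρ : Equiv.Perm γ) :
    ¬ Equiv.Perm.SameCycle (Equiv.sumCongr τ ρ) (Sum.inl x) (Sum.inl y) := by
  intro h'
  have := h'.map_eq (h := Sum.elim (fun a => τ.SameCycle x a) (fun _ => False)) (by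
    rintro (a | c) <;> simp)
  exact h (this.mp (.refl _ _))

/-! ### Planarity under contractions and splits. -/

namespace BoundaryGraph

variable {n : ℕ} {G H : BoundaryGraph n}

theorem half_finite [NeZero n] (G : BoundaryGraph n) : Finite G.Half :=
  have := G.finite
  inferInstance

theorem isPlanar_iff (G : BoundaryGraph n) : G.IsPlanar ↔
    (∀ f : G.Half → Prop, (∀ a, f (G.white a) = f a) → (∀ a, f (G.outerBlack a) = f a) →
      ∀ a b, f a = f b) ∧
    numCycles G.white + numCycles G.outerBlack + numCycles (G.white * G.outerBlack) =
      Nat.card G.Half + 2 := by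
  unfold IsPlanar
  rw [isPretransitive_closure_pair_iff, face, ← mul_inv_rev, numCycles_inv]

theorem card_half_eq_add_two [NeZero n] {ι : H.E → G.E} {x y : G.E} (hinj : Function.Injective ι)
    (hxy : x ≠ y) (hι : Set.range ι = {x, y}ᶜ) : Nat.card G.Half = Nat.card H.Half + 2 := by
  have := G.finite
  have := H.finite
  rw [Nat.card_sum, Nat.card_sum, ← Nat.card_range_of_injective hinj, hι]
  have h1 := Set.ncard_add_ncard_compl ({x, y} : Set G.E)
  rw [Set.ncard_pair hxy] at h1
  rw [← Nat.card_coe_set_eq] at h1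
  omega

/-- The black and the white count each drop by one, the face count is unchanged, and there are two
half-edges fewer. -/
theorem IsContraction.isPlanar [NeZero n] {ι : H.E → G.E} (h : IsContraction G H ι)
    (hG : G.IsPlanar) : H.IsPlanar := by
  obtain ⟨hinj, x, y, hxy, hι, hbx, hby, hw, hb, hwm⟩ := h
  rw [isPlanar_iff] at hG ⊢
  have := G.half_finite
  have hι' := range_sumMap_id (γ := ZMod n) hι
  have hinj' : Function.Injective (Sum.map ι (id : ZMod n → ZMod n)) :=
    Sum.map_injective.2 ⟨hinj, Function.injective_id⟩
  have hm : IsMerge G.white (Sum.inl x) (Sum.inl y) (Sum.map ι id) H.white :=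
    isMerge_of_mergeCycles hw hι' hwm
  have hσx : G.outerBlack (Sum.inl x) = Sum.inl y := congrArg Sum.inl hbx
  have hσy : G.outerBlack (Sum.inl y) = Sum.inl x := congrArg Sum.inl hby
  have hσ : ∀ b, Sum.map ι id (H.outerBlack b) = G.outerBlack (Sum.map ι id b) := by
    rintro (b | i)
    · exact congrArg Sum.inl (hb b)
    · rfl
  -- Otherwise `x` and `y` would form a whole component, which does not contain the leg `0`.
  have hns : G.white (Sum.inl x) ≠ Sum.inl x ∨ G.white (Sum.inl y) ≠ Sum.inl y := by
    by_contra hcon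
    push Not at hcon
    have := hG.1 (fun a => a = Sum.inl x ∨ a = Sum.inl y)
      (fun a => by
        refine propext (or_congr ?_ ?_)
        · conv_lhs => rw [← hcon.1]
          exact G.white.injective.eq_iff
        · conv_lhs => rw [← hcon.2]
          exact G.white.injective.eq_iff)
      (fun a => by
        rw [or_comm]
        refine propext (or_congr ?_ ?_)
        · conv_lhs => rw [← hσx]
          exact G.outerBlack.injective.eq_iff
        · conv_lhs => rw [← hσy]
          exact G.outerBlack.injective.eq_iff)
      (Sum.inl x) (Sum.inr 0)
    simp at this
  refine ⟨hm.connected_of_connected hinj' hι' hw hns hσx hσy hσ hG.1, ?_⟩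
  have h1 := hm.numCycles_eq_add_one hinj' hι' hw hns
  have h2 := numCycles_eq_add_one_of_two_cycle hinj' hι' hσx hσy hσ
  have h3 := hm.numCycles_mul_eq hinj' hι' hw hns hσx hσy hσ
  rw [numCycles_mul_comm, numCycles_mul_comm H.outerBlack] at h3
  have h4 := card_half_eq_add_two hinj hxy hι
  have h5 := hG.2
  omega

/-- A split read backwards contracts a white vertex of degree `2`, so the merging lemmas apply with
black and white exchanged and with `G` as the contracted graph. -/
theorem IsSplit.isPlanar [NeZero n] {ι : G.E → H.E} (h : IsSplit G H ι)
    (hG : G.IsPlanar) : H.IsPlanar := by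
  obtain ⟨hinj, x, y, hxy, hι, hwx, hwy, hb, hdx, -, hbm, hw⟩ := h
  rw [isPlanar_iff] at hG ⊢
  have := H.half_finite
  have hι' := range_sumMap_id (γ := ZMod n) hι
  have hinj' : Function.Injective (Sum.map ι (id : ZMod n → ZMod n)) :=
    Sum.map_injective.2 ⟨hinj, Function.injective_id⟩
  have hm : IsMerge H.outerBlack (Sum.inl x) (Sum.inl y) (Sum.map ι id) G.outerBlack :=
    (isMerge_of_mergeCycles hb hι hbm).sumCongr _
  have hb' := not_sameCycle_sumCongr hb (Equiv.addRight (1 : ZMod n))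
  have hns : H.outerBlack (Sum.inl x) ≠ Sum.inl x ∨ H.outerBlack (Sum.inl y) ≠ Sum.inl y := by
    refine Or.inl fun h => hdx ?_
    have h : H.black x = x := Sum.inl_injective h
    rw [h, h]
  have hσ : ∀ b, Sum.map ι id (G.white b) = H.white (Sum.map ι id b) := hw
  have hc := hm.connected_of_connected' hι' hb' hns hwx hσ
    (fun f h1 h2 => hG.1 f h2 h1)
  refine ⟨fun f h1 h2 => hc f h2 h1, ?_⟩
  have h1 := hm.numCycles_eq_add_one hinj' hι' hb' hns
  have h2 := numCycles_eq_add_one_of_two_cycle hinj' hι' hwx hwy hσ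
  have h3 := hm.numCycles_mul_eq hinj' hι' hb' hns hwx hwy hσ
  have h4 := card_half_eq_add_two hinj hxy hι
  have h5 := hG.2
  omega

theorem face_eq_iff (G : BoundaryGraph n) {a b : G.Half} :
    G.face a = b ↔ G.white (G.outerBlack b) = a := by
  unfold face
  rw [Equiv.Perm.mul_apply, Equiv.Perm.inv_eq_iff_eq, Equiv.Perm.inv_eq_iff_eq]
  exact eq_comm

theorem outerBlack_face (G : BoundaryGraph n) (c : G.Half) :
    G.outerBlack (G.face c) = G.white⁻¹ c := by
  simp [face]

theorem face_white (G : BoundaryGraph n) (c : G.Half) :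
    G.face (G.white c) = G.outerBlack⁻¹ c := by
  simp [face]

/-! ### Planarity of the star graph. -/

section Star

variable [NeZero n] (G : BoundaryGraph n)

/-- The edge of the star graph at a corner. -/
def corner (c : G.Half) : G.star.E := c

/-- The corner of an edge of the star graph. -/
def cornerOf (s : G.star.E) : G.Half := s

theorem cornerOf_corner (c : G.Half) : G.cornerOf (G.corner c) = c := rfl

theorem star_half_cases {P : G.star.Half → Prop} (h1 : ∀ e, P (Sum.inl (G.corner (Sum.inl e))))
    (h2 : ∀ i, P (Sum.inl (G.corner (Sum.inr i)))) (h3 : ∀ i, P (Sum.inr i)) : ∀ z, P z := by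
  rintro ((e | i) | i)
  · exact h1 e
  · exact h2 i
  · exact h3 i

theorem star_white_edge (e : G.E) :
    G.star.white (Sum.inl (G.corner (Sum.inl e))) =
      Sum.inl (G.corner (Sum.inl (G.black e))) := rfl

theorem star_white_boundary (i : ZMod n) :
    G.star.white (Sum.inl (G.corner (Sum.inr i))) = Sum.inr i := rfl

theorem star_white_leg (i : ZMod n) :
    G.star.white (Sum.inr i) = Sum.inl (G.corner (Sum.inr i)) := rfl

theorem star_outerBlack_inl (c : G.Half) :
    G.star.outerBlack (Sum.inl (G.corner c)) = Sum.inl (G.corner (G.face c)) := rfl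

theorem star_outerBlack_inr (i : ZMod n) :
    G.star.outerBlack (Sum.inr i) = Sum.inr (i + 1) := rfl

theorem star_face_edge (e : G.E) :
    G.star.face (Sum.inl (G.corner (Sum.inl e))) = Sum.inl (G.corner (G.white (Sum.inl e))) := by
  rw [face_eq_iff, star_outerBlack_inl, face_white]
  rw [show G.outerBlack⁻¹ (Sum.inl e) = Sum.inl (G.black⁻¹ e) by
    rw [Equiv.Perm.inv_eq_iff_eq]; simp [outerBlack]]
  rw [star_white_edge]; simp

theorem star_face_boundary (i : ZMod n) :
    G.star.face (Sum.inl (G.corner (Sum.inr i))) = Sum.inr (i - 1) := by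
  rw [face_eq_iff, star_outerBlack_inr, star_white_leg, sub_add_cancel]

theorem star_face_leg (i : ZMod n) :
    G.star.face (Sum.inr i) = Sum.inl (G.corner (G.white (Sum.inr (i + 1)))) := by
  rw [face_eq_iff, star_outerBlack_inl, face_white]
  rw [show G.outerBlack⁻¹ (Sum.inr (i + 1)) = Sum.inr i by
    rw [Equiv.Perm.inv_eq_iff_eq]; simp [outerBlack]]
  rw [star_white_boundary]

theorem numCycles_star_white : numCycles G.star.white = numCycles G.black + n := by
  have := G.finite
  have h1 : numCycles (1 : Equiv.Perm (ZMod n)) = n := by simp [numCycles_one]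
  refine Eq.trans ?_ (congrArg (numCycles G.black + ·) h1)
  refine Eq.trans ?_ (numCycles_sumCongr G.black (1 : Equiv.Perm (ZMod n)))
  symm
  refine numCycles_eq_of_maps _ _ (fun c => Sum.inl (G.corner c))
    (Sum.elim G.cornerOf Sum.inr) ?_ ?_ ?_ ?_
  · rintro (e | i)
    · exact ⟨1, by simp [star_white_edge]⟩
    · exact .refl _ _
  · refine G.star_half_cases (fun e => ?_) (fun i => ?_) (fun i => ?_)
    · exact ⟨1, by simp [star_white_edge, cornerOf_corner]⟩
    · exact .refl _ _
    · exact .refl _ _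
  · intro b
    exact .refl _ _
  · refine G.star_half_cases (fun e => .refl _ _) (fun i => .refl _ _) (fun i => ?_)
    exact Equiv.Perm.SameCycle.symm ⟨1, by simp [star_white_leg]⟩

theorem numCycles_outerBlack : numCycles G.outerBlack = numCycles G.black + 1 := by
  have := G.finite
  rw [outerBlack, numCycles_sumCongr,
    numCycles_eq_one (Equiv.addRight (1 : ZMod n)) sameCycle_addRight_one]

theorem numCycles_star_face : numCycles G.star.face = numCycles G.white := by
  symm
  refine numCycles_eq_of_maps _ _ (fun c => Sum.inl (G.corner c))
    (Sum.elim G.cornerOf fun i => G.white (Sum.inr (i + 1))) ?_ ?_ ?_ ?_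
  · rintro (e | i)
    · exact ⟨1, by rw [zpow_one, star_face_edge]⟩
    -- Passing a boundary corner takes two steps, because the leg `i - 1` comes in between.
    · refine ⟨2, ?_⟩
      rw [zpow_two, Equiv.Perm.mul_apply, star_face_boundary, star_face_leg, sub_add_cancel]
  · refine G.star_half_cases (fun e => ?_) (fun i => ?_) (fun i => ?_)
    · rw [star_face_edge]; exact ⟨1, rfl⟩
    · rw [star_face_boundary]
      exact ⟨1, by rw [Sum.elim_inr, sub_add_cancel]; rfl⟩
    · rw [star_face_leg]
      exact .refl _ _
  · intro b
    exact .refl _ _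
  · refine G.star_half_cases (fun e => .refl _ _) (fun i => .refl _ _) (fun i => ?_)
    exact Equiv.Perm.SameCycle.symm ⟨1, by rw [zpow_one, star_face_leg]; rfl⟩

/-- Black vertices, faces and white vertices of `G` become white vertices, black vertices and faces
of the star graph. The boundary adds `n` white vertices and `n` half-edges, so Euler's formula is
preserved. -/
theorem isPlanar_star (hG : G.IsPlanar) : G.star.IsPlanar := by
  have := G.half_finite
  have := G.finite
  refine ⟨?_, ?_⟩
  · rw [isPretransitive_closure_pair_iff]
    have hc := ((isPlanar_iff G).1 hG).1
    intro f hw hb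
    have hleg : ∀ i, f (Sum.inr i) = f (Sum.inl (G.corner (Sum.inr i))) := fun i =>
      (hw (Sum.inr i)).symm
    have hface : ∀ c, f (Sum.inl (G.corner (G.face c))) = f (Sum.inl (G.corner c)) :=
      fun c => hb (Sum.inl c)
    have hob : ∀ c, f (Sum.inl (G.corner (G.outerBlack c))) = f (Sum.inl (G.corner c)) := by
      rintro (e | i)
      · exact hw (Sum.inl (Sum.inl e))
      · have := hb (Sum.inr i)
        rw [star_outerBlack_inr, hleg, hleg] at this
        exact this
    have hwh : ∀ c, f (Sum.inl (G.corner (G.white c))) = f (Sum.inl (G.corner c)) := by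
      intro c
      rw [← hface (G.white c), face_white, ← hob (G.outerBlack⁻¹ c)]
      simp
    have key := hc (fun c => f (Sum.inl (G.corner c))) hwh hob
    rintro (a | i) (b | j)
    · exact key a b
    · rw [hleg]; exact key _ _
    · rw [hleg]; exact key _ _
    · rw [hleg, hleg]; exact key _ _
  · have h1 := hG.2
    rw [numCycles_outerBlack] at h1
    rw [numCycles_star_white, numCycles_star_face, numCycles_outerBlack]
    have h2 : Nat.card G.star.Half = Nat.card G.Half + n := by
      refine (Nat.card_sum (α := G.Half) (β := ZMod n)).trans ?_
      simp
    rw [h2]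
    change _ + _ + (numCycles G.face + 1) + _ = _
    omega

end Star

theorem Splits.isPlanar [NeZero n] {ι : G.E → H.E} (h : Splits G H ι) (hG : G.IsPlanar) :
    H.IsPlanar := by
  induction h with
  | refl => exact hG
  | step _ hs ih => exact hs.isPlanar ih

theorem Contractions.isPlanar [NeZero n] {ι : H.E → G.E} (h : Contractions G H ι)
    (hG : G.IsPlanar) : H.IsPlanar := by
  induction h with
  | refl => exact hG
  | step _ hs ih => exact hs.isPlanar ih

end BoundaryGraph

/-! ### Exactness on a planar map -/

section Exactness

variable {α : Type}

/-- The difference operator of a permutation. -/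
def permDiff (p : Equiv.Perm α) : (α → ℚ) →ₗ[ℚ] (α → ℚ) :=
  LinearMap.funLeft ℚ ℚ p - LinearMap.id

theorem permDiff_apply (p : Equiv.Perm α) (g : α → ℚ) (a : α) :
    permDiff p g a = g (p a) - g a := rfl

theorem mem_ker_permDiff {p : Equiv.Perm α} {g : α → ℚ} :
    g ∈ LinearMap.ker (permDiff p) ↔ ∀ a, g (p a) = g a := by
  simp [LinearMap.mem_ker, funext_iff, permDiff_apply, sub_eq_zero]

variable [Finite α]

theorem finrank_ker_permDiff (p : Equiv.Perm α) :
    Module.finrank ℚ (LinearMap.ker (permDiff p)) = numCycles p := by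
  classical
  have := Fintype.ofFinite (Quotient (Equiv.Perm.SameCycle.setoid p))
  let e : LinearMap.ker (permDiff p) ≃ₗ[ℚ] (Quotient (Equiv.Perm.SameCycle.setoid p) → ℚ) :=
    { toFun := fun g => Quotient.lift g.1 fun _ _ h =>
        Equiv.Perm.SameCycle.map_eq (mem_ker_permDiff.1 g.2) h
      map_add' := fun g g' => by funext a; induction a using Quotient.inductionOn; rfl
      map_smul' := fun c g => by funext a; induction a using Quotient.inductionOn; rfl
      invFun := fun g => ⟨fun a => g (Quotient.mk _ a), mem_ker_permDiff.2 fun a =>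
        congrArg g (Quotient.sound (Equiv.Perm.sameCycle_apply_left.2 (.refl _ _)))⟩
      left_inv := fun g => rfl
      right_inv := fun g => by funext a; induction a using Quotient.inductionOn; rfl }
  rw [e.finrank_eq, Module.finrank_pi, numCycles, Nat.card_eq_fintype_card]

theorem finrank_range_permDiff (p : Equiv.Perm α) :
    Module.finrank ℚ (LinearMap.range (permDiff p)) + numCycles p = Nat.card α := by
  have := Fintype.ofFinite α
  rw [← finrank_ker_permDiff p, LinearMap.finrank_range_add_finrank_ker, Module.finrank_pi,
    Nat.card_eq_fintype_card]

theorem finrank_comap_le {V W : Type*} [AddCommGroup V] [Module ℚ V] [AddCommGroup W] [Module ℚ W]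
    [FiniteDimensional ℚ V] (L : V →ₗ[ℚ] W) (S : Submodule ℚ W) :
    Module.finrank ℚ (S.comap L) ≤
      Module.finrank ℚ (LinearMap.ker L) +
        Module.finrank ℚ (LinearMap.range L ⊓ S : Submodule ℚ W) := by
  have h1 := LinearMap.finrank_range_add_finrank_ker (L.domRestrict (S.comap L))
  rw [LinearMap.range_domRestrict, Submodule.map_comap_eq] at h1
  have h2 : Module.finrank ℚ (LinearMap.ker (L.domRestrict (S.comap L))) ≤
      Module.finrank ℚ (LinearMap.ker L) := by
    rw [LinearMap.ker_domRestrict]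
    have h3 : ((LinearMap.ker L).comap (S.comap L).subtype).map (S.comap L).subtype ≤
      LinearMap.ker L := Submodule.map_comap_le _ _
    have h4 := Submodule.finrank_mono h3
    rwa [Submodule.finrank_map_subtype_eq] at h4
  omega

theorem finrank_span_singleton_le {V : Type*} [AddCommGroup V] [Module ℚ V] (v : V) :
    Module.finrank ℚ (Submodule.span ℚ {v}) ≤ 1 := by
  simpa using finrank_span_le_card (R := ℚ) ({v} : Set V)

/-- This is the vanishing of the first cohomology of the sphere, by counting dimensions. With `N`
half-edges and `c_w`, `c_b`, `c_f` cycles, the solutions `Z` of the cocycle condition have dimension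
at most `N - c_f + 1`. The subspace `Y` of sums of functions constant on black and on white vertices
has dimension at least `c_w + c_b - 1`. Euler's formula equates the two bounds. -/
theorem exists_potential [Nonempty α] (w b f : Equiv.Perm α) (hf : f = b⁻¹ * w⁻¹)
    (hconn : ∀ F : α → Prop, (∀ a, F (w a) = F a) → (∀ a, F (b a) = F a) → ∀ a a', F a = F a')
    (heuler : numCycles w + numCycles b + numCycles f = Nat.card α + 2)
    (m u : α → ℚ) (hm : ∀ z, m z - m (w⁻¹ z) = u (f z) - u z) :
    ∃ P Q : α → ℚ, (∀ z, P (w z) = P z) ∧ (∀ z, Q (b z) = Q z) ∧ ∀ z, Q z - P z = m z := by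
  classical
  have := Fintype.ofFinite α
  let z₀ : α := Classical.arbitrary α
  let U := LinearMap.range (permDiff w⁻¹) ⊔ LinearMap.range (permDiff f)
  have hfinv : ∀ z, f⁻¹ z = w (b z) := fun z => by rw [hf]; simp
  -- `U` has codimension at most one
  have hU : Nat.card α ≤ Module.finrank ℚ U + 1 := by
    let T := U ⊔ Submodule.span ℚ {Pi.single z₀ (1 : ℚ)}
    have hsingle : ∀ p : Equiv.Perm α, ∀ z, permDiff p (Pi.single z 1) =
        Pi.single (p⁻¹ z) 1 - Pi.single z (1 : ℚ) := by
      intro p z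
      funext a
      rw [permDiff_apply, Pi.sub_apply]
      congr 1
      simp only [Pi.single_apply, Equiv.Perm.eq_inv_iff_eq]
    have hmem : ∀ {v v' : α → ℚ}, v - v' ∈ U → (v ∈ T) = (v' ∈ T) := by
      intro v v' h
      have h' : v - v' ∈ T := Submodule.mem_sup_left h
      refine propext ⟨fun hv => ?_, fun hv => ?_⟩
      · simpa using T.sub_mem hv h'
      · simpa using T.add_mem h' hv
    have hw : ∀ z, ((Pi.single (w z) (1 : ℚ) : α → ℚ) ∈ T) = (Pi.single z (1 : ℚ) ∈ T) := by
      intro z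
      refine hmem (Submodule.mem_sup_left ⟨Pi.single z 1, ?_⟩)
      rw [hsingle]; simp
    have hff : ∀ z, ((Pi.single (w (b z)) (1 : ℚ) : α → ℚ) ∈ T) = (Pi.single z (1 : ℚ) ∈ T) := by
      intro z
      refine hmem (Submodule.mem_sup_right ⟨Pi.single z 1, ?_⟩)
      rw [hsingle, hfinv]
    -- The indicators of `z`, `w z` and `w (b z)` agree modulo `U`, so connectedness spreads
    -- membership in `T` from `z₀` to every point.
    have hall := hconn (fun z => (Pi.single z (1 : ℚ) : α → ℚ) ∈ T) hw
      (fun z => by rw [← hw (b z), hff])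
    have hT : T = ⊤ := by
      rw [eq_top_iff]
      intro g _
      rw [pi_eq_sum_univ' g]
      refine T.sum_mem fun z _ => T.smul_mem _ ?_
      have := (hall z₀ z).mp (Submodule.mem_sup_right (Submodule.mem_span_singleton_self _))
      convert this using 1
    have h1 : Module.finrank ℚ T = Nat.card α := by
      rw [hT, finrank_top, Module.finrank_pi, Nat.card_eq_fintype_card]
    have h2 := Submodule.finrank_add_le_finrank_add_finrank U
      (Submodule.span ℚ {Pi.single z₀ (1 : ℚ)})
    have h3 : Module.finrank ℚ (Submodule.span ℚ {(Pi.single z₀ (1 : ℚ) : α → ℚ)}) ≤ 1 :=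
      finrank_span_singleton_le _
    change Module.finrank ℚ T ≤ _ at h2
    omega
  -- invariant functions
  have hinf : Module.finrank ℚ (LinearMap.ker (permDiff b) ⊓ LinearMap.ker (permDiff w) :
      Submodule ℚ (α → ℚ)) ≤ 1 := by
    refine (Submodule.finrank_mono (t := Submodule.span ℚ {(fun _ => 1 : α → ℚ)}) ?_).trans
      (finrank_span_singleton_le _)
    rintro g ⟨hb, hw⟩
    rw [SetLike.mem_coe, mem_ker_permDiff] at hb hw
    rw [Submodule.mem_span_singleton]
    refine ⟨g z₀, ?_⟩
    funext z
    have := (hconn (fun z => g z = g z₀) (fun z => by rw [hw]) (fun z => by rw [hb]) z₀ z).mp rfl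
    simp [this]
  let Z := (LinearMap.range (permDiff f)).comap (permDiff w⁻¹)
  let Y := LinearMap.ker (permDiff b) ⊔ LinearMap.ker (permDiff w)
  have hYZ : Y ≤ Z := by
    refine sup_le ?_ ?_
    · intro g hg
      rw [mem_ker_permDiff] at hg
      refine ⟨g, ?_⟩
      funext z
      rw [permDiff_apply, permDiff_apply, ← hg (f z), hf]
      simp
    · intro g hg
      rw [mem_ker_permDiff] at hg
      refine ⟨0, ?_⟩
      funext z
      rw [permDiff_apply, permDiff_apply, ← hg (w⁻¹ z)]
      simp
  have hdim : Module.finrank ℚ Z ≤ Module.finrank ℚ Y := by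
    have h1 := finrank_comap_le (permDiff w⁻¹) (LinearMap.range (permDiff f))
    have h2 := Submodule.finrank_sup_add_finrank_inf_eq (LinearMap.range (permDiff w⁻¹))
      (LinearMap.range (permDiff f))
    have h3 := Submodule.finrank_sup_add_finrank_inf_eq (LinearMap.ker (permDiff b))
      (LinearMap.ker (permDiff w))
    have h4 := finrank_range_permDiff w⁻¹
    have h5 := finrank_range_permDiff f
    rw [finrank_ker_permDiff] at h1
    rw [finrank_ker_permDiff, finrank_ker_permDiff] at h3
    rw [numCycles_inv] at h1 h4
    change Module.finrank ℚ Z ≤ _ at h1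
    change Module.finrank ℚ U + _ = _ at h2
    change Module.finrank ℚ Y + _ = _ at h3
    omega
  have hZ : Y = Z := Submodule.eq_of_le_of_finrank_le hYZ hdim
  have hmZ : -m ∈ Z := by
    refine ⟨u, ?_⟩
    funext z
    rw [permDiff_apply, permDiff_apply, ← hm, Pi.neg_apply, Pi.neg_apply]
    ring
  rw [← hZ] at hmZ
  obtain ⟨Q, hQ, P, hP, hPQ⟩ := Submodule.mem_sup.1 hmZ
  rw [mem_ker_permDiff] at hQ hP
  refine ⟨P, fun z => -Q z, hP, fun z => congrArg Neg.neg (hQ z), fun z => ?_⟩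
  have := congrFun hPQ z
  simp only [Pi.add_apply, Pi.neg_apply] at this
  linarith

end Exactness

theorem BoundaryGraph.IsPlanar.exists_potential {n : ℕ} [NeZero n] {G : BoundaryGraph n}
    (hG : G.IsPlanar) (m u : G.Half → ℚ) (hm : ∀ z, m z - m (G.white⁻¹ z) = u (G.face z) - u z) :
    ∃ P Q : G.Half → ℚ, (∀ z, P (G.white z) = P z) ∧ (∀ z, Q (G.outerBlack z) = Q z) ∧
      ∀ z, Q z - P z = m z := by
  have := G.half_finite
  have : Nonempty G.Half := ⟨Sum.inr 0⟩
  exact _root_.exists_potential _ _ _ rfl ((isPlanar_iff G).1 hG).1 hG.2 m u hm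

namespace BoundaryGraph

open Relation

variable {n : ℕ} {G : BoundaryGraph n}

/-! ### Zig-zag paths -/

theorem next_toWhite_iff {z : G.Half} {d : G.Dart} :
    G.Next (.toWhite z) d ↔ d = .fromWhite (G.white⁻¹ z) :=
  ⟨fun h => G.next_rightUnique h (Next.atWhite z), fun h => h ▸ Next.atWhite z⟩

theorem next_fromWhite_iff {e : G.E} {d : G.Dart} :
    G.Next (.fromWhite (Sum.inl e)) d ↔ d = .toWhite (Sum.inl (G.black e)) :=
  ⟨fun h => G.next_rightUnique h (Next.atBlack e), fun h => h ▸ Next.atBlack e⟩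

theorem next_to_fromWhite_iff {h : G.Half} {d : G.Dart} :
    G.Next d (.fromWhite h) ↔ d = .toWhite (G.white h) := by
  have h0 : G.Next (.toWhite (G.white h)) (.fromWhite h) := by simp [next_toWhite_iff]
  exact ⟨fun h' => G.next_leftUnique h' h0, fun h' => h' ▸ h0⟩

theorem next_to_toWhite_iff {e : G.E} {d : G.Dart} :
    G.Next d (.toWhite (Sum.inl e)) ↔ d = .fromWhite (Sum.inl (G.black⁻¹ e)) := by
  have h0 : G.Next (.fromWhite (Sum.inl (G.black⁻¹ e))) (.toWhite (Sum.inl e)) := by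
    simp [next_fromWhite_iff]
  exact ⟨fun h' => G.next_leftUnique h' h0, fun h' => h' ▸ h0⟩

theorem Reaches.trans {a b c : G.Dart} (h : G.Reaches a b) (h' : G.Reaches b c) :
    G.Reaches a c := ReflTransGen.trans h h'

theorem Reaches.refl (a : G.Dart) : G.Reaches a a := ReflTransGen.refl

theorem Reaches.of_transGen {a b : G.Dart} (h : TransGen G.Next a b) : G.Reaches a b :=
  TransGen.to_reflTransGen h

theorem Reaches.of_next {a b : G.Dart} (h : G.Next a b) : G.Reaches a b := ReflTransGen.single h

theorem Reaches.transGen {a b : G.Dart} (h : G.Reaches a b) (hne : a ≠ b) :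
    TransGen G.Next a b := by
  rcases reflTransGen_iff_eq_or_transGen.1 h with h | h
  · exact absurd h.symm hne
  · exact h

/-- A path that goes on goes on along the next directed edge. -/
theorem Reaches.of_next_of_transGen {a b c : G.Dart} (hb : G.Next a b)
    (h : TransGen G.Next a c) : G.Reaches b c := by
  obtain ⟨b', h1, h2⟩ := TransGen.head'_iff.1 h
  rwa [G.next_rightUnique hb h1]

theorem Reaches.of_transGen_of_next {a b c : G.Dart} (hb : G.Next b c)
    (h : TransGen G.Next a c) : G.Reaches a b := by
  obtain ⟨b', h1, h2⟩ := TransGen.tail'_iff.1 h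
  rwa [G.next_leftUnique hb h2]

theorem Reaches.pred_of_source {i : ZMod n} {a b : G.Dart} (hab : G.Next a b)
    (h : G.Reaches (G.source i) b) : G.Reaches (G.source i) a := by
  refine Reaches.of_transGen_of_next hab (h.transGen ?_)
  rintro rfl
  exact G.not_next_source _ _ hab

theorem Reaches.total_of_left {a b c : G.Dart} (hb : G.Reaches a b) (hc : G.Reaches a c) :
    G.Reaches b c ∨ G.Reaches c b :=
  ReflTransGen.total_of_right_unique G.next_rightUnique hb hc

theorem not_transGen_source {d : G.Dart} {i : ZMod n} : ¬ TransGen G.Next d (G.source i) := by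
  intro h
  obtain ⟨b', h1, h2⟩ := TransGen.tail'_iff.1 h
  exact G.not_next_source _ _ h2

theorem Reaches.eq_of_sink {d : G.Dart} {j : ZMod n} (h : G.Reaches (G.sink j) d) :
    d = G.sink j := by
  rcases ReflTransGen.cases_head h with h | ⟨c, h, -⟩
  · exact h.symm
  · exact absurd h (G.not_sink_next _ _)

instance finite_dart [NeZero n] (G : BoundaryGraph n) : Finite G.Dart := by
  have := G.half_finite
  refine Finite.of_injective (β := G.Half ⊕ G.Half)
    (fun d => match d with | .toWhite x => Sum.inl x | .fromWhite x => Sum.inr x) ?_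
  rintro (x | x) (y | y) h <;> simp_all

/-- Without closed loops, every directed edge lies on the path from some source. -/
theorem exists_source [NeZero n] (hloop : ∀ d : G.Dart, ¬ TransGen G.Next d d) (d : G.Dart) :
    ∃ i, G.Reaches (G.source i) d := by
  have : Std.Irrefl (TransGen G.Next) := ⟨hloop⟩
  have hwf : WellFounded (TransGen G.Next) := Finite.wellFounded_of_trans_of_irrefl _
  induction d using hwf.induction with
  | _ d ih =>
    have step : ∀ c, G.Next c d → ∃ i, G.Reaches (G.source i) d := fun c hc => by
      obtain ⟨i, hi⟩ := ih c (TransGen.single hc)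
      exact ⟨i, hi.tail hc⟩
    rcases d with (e | i) | h
    · exact step _ (next_to_toWhite_iff.2 rfl)
    · exact ⟨i, ReflTransGen.refl⟩
    · exact step _ (next_to_fromWhite_iff.2 rfl)

theorem exists_sink_of_source [NeZero n] {i : ZMod n} {d : G.Dart}
    (h : G.Reaches (G.source i) d) : ∃ j, G.Reaches d (G.sink j) := by
  obtain ⟨j, hj⟩ := G.exists_sink i
  refine ⟨j, ?_⟩
  rcases h.total_of_left hj with h' | h'
  · exact h'
  · rw [h'.eq_of_sink]
    exact ReflTransGen.refl

/-! ### Potentials -/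

/-- `P` on the white vertices and `Q` on the black vertices is a potential for `m`. -/
structure IsPotential (G : BoundaryGraph n) (m P Q : G.Half → ℚ) : Prop where
  white : ∀ z, P (G.white z) = P z
  black : ∀ z, Q (G.outerBlack z) = Q z
  diff : ∀ z, Q z - P z = m z
  leg_white : ∀ i, P (Sum.inr i) = 0
  leg_black : ∀ i, Q (Sum.inr i) = 0

theorem IsPotential.neg {m P Q : G.Half → ℚ} (h : G.IsPotential m P Q) :
    G.IsPotential (fun z => -m z) (fun z => -P z) (fun z => -Q z) where
  white z := congrArg Neg.neg (h.white z)
  black z := congrArg Neg.neg (h.black z)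
  diff z := by rw [← h.diff]; ring
  leg_white i := by simp [h.leg_white]
  leg_black i := by simp [h.leg_black]

/-- The potential seen from a zig-zag path. -/
def Dart.value (P Q : G.Half → ℚ) : G.Dart → ℚ
  | .toWhite z => P z
  | .fromWhite z => Q z

/-- Along a zig-zag path the value rises by `m` on arriving at `fromWhite e` and falls by `m` on
arriving at `toWhite f`. A drop therefore needs a negative count of the first kind or a positive one
of the second. -/
theorem IsPotential.exists_decrease {m P Q : G.Half → ℚ} (h : G.IsPotential m P Q) {a b : G.Dart}
    (hab : G.Reaches a b) (hlt : b.value P Q < a.value P Q) :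
    (∃ e, TransGen G.Next a (.fromWhite (Sum.inl e)) ∧ G.Reaches (.fromWhite (Sum.inl e)) b ∧
        m (Sum.inl e) < 0) ∨
      ∃ f, TransGen G.Next a (.toWhite (Sum.inl f)) ∧ G.Reaches (.toWhite (Sum.inl f)) b ∧
        0 < m (Sum.inl f) := by
  induction hab with
  | refl => exact absurd hlt (lt_irrefl _)
  | @tail c b hac hcb ih =>
    by_cases hc : c.value P Q < a.value P Q
    · rcases ih hc with ⟨e, h1, h2, h3⟩ | ⟨f, h1, h2, h3⟩
      · exact Or.inl ⟨e, h1, h2.tail hcb, h3⟩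
      · exact Or.inr ⟨f, h1, h2.tail hcb, h3⟩
    · have hlt' : b.value P Q < c.value P Q := hlt.trans_le (not_lt.1 hc)
      have hab : TransGen G.Next a b := TransGen.tail' hac hcb
      cases hcb with
      | atWhite z =>
        have h1 := h.diff (G.white⁻¹ z)
        have h2 := h.white (G.white⁻¹ z)
        simp only [Dart.value] at hlt'
        rw [← Equiv.Perm.mul_apply, mul_inv_cancel, Equiv.Perm.one_apply] at h2
        rcases hz : G.white⁻¹ z with e | i
        · rw [hz] at h1 h2 hlt' hab
          exact Or.inl ⟨e, hab, ReflTransGen.refl, by linarith⟩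
        · rw [hz] at h2 hlt'
          rw [h.leg_white] at h2
          rw [h.leg_black] at hlt'
          linarith
      | atBlack e =>
        have h1 := h.diff (Sum.inl (G.black e))
        have h2 : Q (Sum.inl (G.black e)) = Q (Sum.inl e) := h.black (Sum.inl e)
        simp only [Dart.value] at hlt'
        exact Or.inr ⟨_, hab, ReflTransGen.refl, by linarith⟩

theorem IsPotential.exists_increase {m P Q : G.Half → ℚ} (h : G.IsPotential m P Q) {a b : G.Dart}
    (hab : G.Reaches a b) (hlt : a.value P Q < b.value P Q) :
    (∃ e, TransGen G.Next a (.fromWhite (Sum.inl e)) ∧ G.Reaches (.fromWhite (Sum.inl e)) b ∧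
        0 < m (Sum.inl e)) ∨
      ∃ f, TransGen G.Next a (.toWhite (Sum.inl f)) ∧ G.Reaches (.toWhite (Sum.inl f)) b ∧
        m (Sum.inl f) < 0 := by
  have := h.neg.exists_decrease hab (by
    rcases a with z | z <;> rcases b with z' | z' <;> simpa [Dart.value] using hlt)
  simpa using this

/-- A chain `A`, `B` on the corners, with boundary `δ` in the faces, has a potential. -/
theorem exists_isPotential [NeZero n] (hG : G.IsPlanar) (A B δ D : G.Half → ℚ)
    (hAB : ∀ h, A (G.outerBlack h) = B h) (hBA : ∀ z, B (G.white⁻¹ z) = A z + δ z)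
    (hD : ∀ z, D (G.face z) - D z = δ z) (hA0 : ∀ i, A (Sum.inr i) = 0)
    (hB0 : ∀ i, B (Sum.inr i) = 0) :
    ∃ P Q, G.IsPotential (fun z => A z + B z) P Q ∧
      ∀ z z', G.face.SameCycle z z' → P z + A z - D z = P z' + A z' - D z' := by
  have hAw : ∀ z, A (G.white⁻¹ z) = B (G.face z) := fun z => by
    rw [← hAB, outerBlack_face]
  -- By `hAB` and `hBA`, the increment of `A + B` at a white vertex is `B z - B (face z) - δ z`;
  -- this dictates `u = -B - D`.
  obtain ⟨P, Q, hP, hQ, hPQ⟩ := hG.exists_potential (fun z => A z + B z) (fun z => -B z - D z)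
    (fun z => by
      rw [hAw, hBA, ← hD]
      ring)
  -- All legs meet at the vertex at infinity. Subtracting the value there makes the winding number
  -- vanish outside.
  have hQ0 : ∀ i, Q (Sum.inr i) = Q (Sum.inr 0) := fun i =>
    (sameCycle_addRight_one i 0).map_eq (h := fun i => Q (Sum.inr i)) fun i => hQ (Sum.inr i)
  refine ⟨fun z => P z - Q (Sum.inr 0), fun z => Q z - Q (Sum.inr 0),
    ⟨fun z => by simp only [hP], fun z => by simp only [hQ], fun z => by rw [← hPQ]; ring,
      fun i => ?_, fun i => by rw [hQ0, sub_self]⟩, ?_⟩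
  · have := hPQ (Sum.inr i)
    simp only [hA0, hB0, hQ0] at this
    linarith
  · intro z z' hz
    refine (hz.map_eq (h := fun z => P z - Q (Sum.inr 0) + A z - D z) fun z => ?_)
    have h1 := hPQ (G.face z)
    have h2 := hQ (G.face z)
    rw [outerBlack_face] at h2
    have h3 := hPQ (G.white⁻¹ z)
    have h4 := hP (G.white⁻¹ z)
    rw [← Equiv.Perm.mul_apply, mul_inv_cancel, Equiv.Perm.one_apply] at h4
    have h5 := hD z
    have h6 := hBA z
    have h7 := hAw z
    linarith

end BoundaryGraph

open Classical in
/-- The indicator of a proposition. -/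
noncomputable def indic (p : Prop) : ℚ := if p then 1 else 0

theorem indic_of {p : Prop} (h : p) : indic p = 1 := if_pos h

theorem indic_of_not {p : Prop} (h : ¬ p) : indic p = 0 := if_neg h

theorem indic_congr {p q : Prop} (h : p ↔ q) : indic p = indic q := by rw [propext h]

theorem indic_nonneg (p : Prop) : 0 ≤ indic p := by
  by_cases h : p
  · rw [indic_of h]; norm_num
  · rw [indic_of_not h]

/-- Two points of a cycle bound an arc of it. -/
theorem exists_arc {α : Type*} [Finite α] (p : Equiv.Perm α) {x y : α} (hxy : x ≠ y)
    (h : p.SameCycle x y) : ∃ D : α → ℚ, D x = 0 ∧ D y = 1 ∧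
      (∀ z, D (p z) - D z = indic (z = x) - indic (z = y)) ∧ ∀ z, ¬ p.SameCycle x z → D z = 0 := by
  classical
  have hex : ∃ k : ℕ, (p ^ k) x = y := by
    obtain ⟨i, hi⟩ := h.exists_nat_pow_eq
    exact ⟨i, hi⟩
  set k := Nat.find hex with hk
  have hkx : (p ^ k) x = y := Nat.find_spec hex
  have hmin : ∀ j < k, (p ^ j) x ≠ y := fun j hj => Nat.find_min hex hj
  have hxj : ∀ j, 1 ≤ j → j ≤ k → (p ^ j) x ≠ x := by
    intro j h1 h2 hj
    refine hmin (k - j) (by omega) ?_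
    have : (p ^ k) x = (p ^ (k - j)) ((p ^ j) x) := by
      rw [← Equiv.Perm.mul_apply, ← pow_add, Nat.sub_add_cancel h2]
    rw [hj, hkx] at this
    exact this.symm
  have hk1 : 1 ≤ k := by
    by_contra h0
    rw [show k = 0 by omega] at hkx
    exact hxy hkx
  have hs : ∀ j, (p ^ (j + 1)) x = p ((p ^ j) x) := fun j => by
    rw [pow_succ', Equiv.Perm.mul_apply]
  -- The arc excludes `x` and includes `y`. Stopping at the first occurrence of `y` keeps it from
  -- returning to `x`.
  refine ⟨fun z => indic (∃ j, 1 ≤ j ∧ j ≤ k ∧ (p ^ j) x = z), ?_, ?_, ?_, ?_⟩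
  · exact indic_of_not (fun ⟨j, h1, h2, h3⟩ => hxj j h1 h2 h3)
  · exact indic_of ⟨k, hk1, le_rfl, hkx⟩
  · intro z
    simp only
    have hp : (∃ j, 1 ≤ j ∧ j ≤ k ∧ (p ^ j) x = p z) ↔ ∃ j, j < k ∧ (p ^ j) x = z := by
      constructor
      · rintro ⟨j, h1, h2, h3⟩
        obtain ⟨l, rfl⟩ : ∃ l, j = l + 1 := ⟨j - 1, by omega⟩
        rw [hs] at h3
        exact ⟨l, by omega, p.injective h3⟩
      · rintro ⟨j, h1, h2⟩
        exact ⟨j + 1, by omega, by omega, by rw [hs, h2]⟩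
    rw [indic_congr hp]
    by_cases hzx : z = x
    · subst hzx
      rw [indic_of (⟨0, by omega, rfl⟩ : ∃ j, j < k ∧ (p ^ j) z = z),
        indic_of_not (fun ⟨j, h1, h2, h3⟩ => hxj j h1 h2 h3), indic_of rfl, indic_of_not hxy]
    by_cases hzy : z = y
    · subst hzy
      rw [indic_of_not (fun ⟨j, h1, h2⟩ => hmin j h1 h2),
        indic_of (⟨k, hk1, le_rfl, hkx⟩ : ∃ j, 1 ≤ j ∧ j ≤ k ∧ (p ^ j) x = z),
        indic_of_not hzx, indic_of rfl]
    · rw [indic_of_not hzx, indic_of_not hzy, sub_self, sub_eq_zero]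
      apply indic_congr
      constructor
      · rintro ⟨j, h1, h2⟩
        refine ⟨j, ?_, h1.le, h2⟩
        by_contra h0
        rw [show j = 0 by omega] at h2
        exact hzx h2.symm
      · rintro ⟨j, h1, h2, h3⟩
        refine ⟨j, lt_of_le_of_ne h2 ?_, h3⟩
        rintro rfl
        exact hzy (h3.symm.trans hkx)
  · intro z hz
    refine indic_of_not ?_
    rintro ⟨j, -, -, rfl⟩
    exact hz ⟨j, by simp⟩

namespace BoundaryGraph

open Relation

variable {n : ℕ} {G : BoundaryGraph n}

/-! ### Segments of zig-zag paths -/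

/-- `d` lies on the zig-zag path after the corner `x` and before the corner `y`. -/
def InSegment (x y : G.Half) (d : G.Dart) : Prop :=
  TransGen G.Next (.toWhite x) d ∧ G.Reaches d (.toWhite y)

theorem not_inSegment_source (x y : G.Half) (i : ZMod n) :
    ¬ InSegment x y (.toWhite (Sum.inr i)) := fun h => not_transGen_source (i := i) h.1

theorem not_inSegment_sink (x y : G.Half) (i : ZMod n) :
    ¬ InSegment x y (.fromWhite (Sum.inr i)) := fun h => by
  have := Reaches.eq_of_sink (j := i) h.2
  cases this

theorem inSegment_outerBlack_iff (x y h : G.Half) :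
    InSegment x y (.toWhite (G.outerBlack h)) ↔ InSegment x y (.fromWhite h) := by
  rcases h with e | i
  · have hn : G.Next (.fromWhite (Sum.inl e)) (.toWhite (Sum.inl (G.black e))) := Next.atBlack e
    constructor
    · rintro ⟨h1, h2⟩
      exact ⟨(Reaches.of_transGen_of_next hn h1).transGen (by simp), ReflTransGen.head hn h2⟩
    · rintro ⟨h1, h2⟩
      exact ⟨h1.tail hn, Reaches.of_next_of_transGen hn (h2.transGen (by simp))⟩
  · exact iff_of_false (not_inSegment_source _ _ _) (not_inSegment_sink _ _ _)

/-- A segment that arrives at a white vertex also departs from it, except that it begins with the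
departure after `x` and ends with the arrival at `y`. -/
theorem indic_inSegment_white (hloop : ∀ d : G.Dart, ¬ TransGen G.Next d d) {x y : G.Half}
    (hxy : TransGen G.Next (.toWhite x) (.toWhite y)) (z : G.Half) :
    indic (InSegment x y (.fromWhite (G.white⁻¹ z))) =
      indic (InSegment x y (.toWhite z)) + (indic (z = x) - indic (z = y)) := by
  have hn : G.Next (.toWhite z) (.fromWhite (G.white⁻¹ z)) := Next.atWhite z
  have hne : x ≠ y := by
    rintro rfl
    exact hloop _ hxy
  have h1 : InSegment x y (.fromWhite (G.white⁻¹ z)) ↔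
      G.Reaches (.toWhite x) (.toWhite z) ∧ TransGen G.Next (.toWhite z) (.toWhite y) := by
    constructor
    · rintro ⟨h1, h2⟩
      exact ⟨Reaches.of_transGen_of_next hn h1, TransGen.head' hn h2⟩
    · rintro ⟨h1, h2⟩
      exact ⟨TransGen.tail' h1 hn, Reaches.of_next_of_transGen hn h2⟩
  rw [indic_congr h1]
  by_cases hzx : z = x
  · subst hzx
    rw [indic_of (p := _ ∧ _) ⟨Reaches.refl _, hxy⟩, indic_of_not (fun h => hloop _ h.1), indic_of rfl,
      indic_of_not hne]
    norm_num
  by_cases hzy : z = y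
  · subst hzy
    rw [indic_of_not (fun h => hloop _ h.2), indic_of (p := InSegment _ _ _) ⟨hxy, ReflTransGen.refl⟩,
      indic_of_not hzx, indic_of rfl]
    norm_num
  · rw [indic_of_not hzx, indic_of_not hzy, sub_self, add_zero]
    apply indic_congr
    constructor
    · rintro ⟨h1, h2⟩
      exact ⟨h1.transGen (by simpa using fun h => hzx h.symm), Reaches.of_transGen h2⟩
    · rintro ⟨h1, h2⟩
      exact ⟨Reaches.of_transGen h1, h2.transGen (by simpa using hzy)⟩

/-- The number of times that a segment goes through an edge. -/
noncomputable def segmentCount (x y : G.Half) (z : G.Half) : ℚ :=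
  indic (InSegment x y (.toWhite z)) + indic (InSegment x y (.fromWhite z))

theorem segmentCount_nonneg (x y z : G.Half) : 0 ≤ segmentCount x y z :=
  add_nonneg (indic_nonneg _) (indic_nonneg _)

theorem of_segmentCount_pos {x y z : G.Half} (h : 0 < segmentCount x y z) :
    InSegment x y (.toWhite z) ∨ InSegment x y (.fromWhite z) := by
  by_contra hcon
  push Not at hcon
  rw [segmentCount, indic_of_not hcon.1, indic_of_not hcon.2] at h
  norm_num at h

theorem segmentCount_eq_zero {x y z : G.Half} (h1 : ¬ InSegment x y (.toWhite z))
    (h2 : ¬ InSegment x y (.fromWhite z)) : segmentCount x y z = 0 := by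
  rw [segmentCount, indic_of_not h1, indic_of_not h2, add_zero]

/-- The segment becomes a closed curve when its ends are joined by an arc `D` of corners of their
common face. -/
theorem exists_segment_potential [NeZero n] (hG : G.IsPlanar)
    (hloop : ∀ d : G.Dart, ¬ TransGen G.Next d d) {x y : G.Half}
    (hxy : TransGen G.Next (.toWhite x) (.toWhite y)) (hf : G.face.SameCycle x y) :
    ∃ P Q, G.IsPotential (segmentCount x y) P Q := by
  have := G.half_finite
  have hne : x ≠ y := by
    rintro rfl
    exact hloop _ hxy
  obtain ⟨D, -, -, hD, -⟩ := exists_arc _ hne hf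
  obtain ⟨P, Q, hPQ, -⟩ := exists_isPotential hG (fun z => indic (InSegment x y (.toWhite z)))
    (fun z => indic (InSegment x y (.fromWhite z))) _ D
    (fun h => indic_congr (inSegment_outerBlack_iff x y h)) (indic_inSegment_white hloop hxy) hD
    (fun i => indic_of_not (not_inSegment_source _ _ _))
    (fun i => indic_of_not (not_inSegment_sink _ _ _))
  exact ⟨P, Q, hPQ⟩

/-- The closed curve follows the first segment forwards and the second one backwards, with arcs in
the two common faces. The quantity `P + A - D` is constant on each face. Between `x` and `x'` only
the arc contributes, by one. At `y` the chain contributes `1`, while at `y'` chain and arc cancel.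
Since the two faces differ, neither arc affects the other face. -/
theorem exists_two_segment_potential [NeZero n] (hG : G.IsPlanar)
    (hloop : ∀ d : G.Dart, ¬ TransGen G.Next d d) {i j : ZMod n} (hij : i ≠ j)
    {x y x' y' : G.Half} (hx : G.Reaches (G.source i) (.toWhite x))
    (hx' : G.Reaches (G.source j) (.toWhite x'))
    (hxy : TransGen G.Next (.toWhite x) (.toWhite y))
    (hxy' : TransGen G.Next (.toWhite x') (.toWhite y'))
    (hf : G.face.SameCycle x x') (hf' : G.face.SameCycle y y') (hff : ¬ G.face.SameCycle x y) :
    ∃ P Q, G.IsPotential (fun z => segmentCount x y z - segmentCount x' y' z) P Q ∧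
      P x' = P x + 1 ∧ P y' = P y + 1 := by
  have := G.half_finite
  have hy : G.Reaches (G.source i) (.toWhite y) := hx.trans (Reaches.of_transGen hxy)
  have hy' : G.Reaches (G.source j) (.toWhite y') := hx'.trans (Reaches.of_transGen hxy')
  have hxx : x ≠ x' := by
    rintro rfl
    exact hij (G.source_injective_of_reaches hx hx')
  have hyy : y ≠ y' := by
    rintro rfl
    exact hij (G.source_injective_of_reaches hy hy')
  obtain ⟨D, hDx, hDx', hD, hDz⟩ := exists_arc _ hxx hf
  obtain ⟨D', hDy, hDy', hD', hDz'⟩ := exists_arc _ hyy hf'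
  obtain ⟨P, Q, hPQ, hW⟩ := exists_isPotential hG
    (fun z => indic (InSegment x y (.toWhite z)) - indic (InSegment x' y' (.toWhite z)))
    (fun z => indic (InSegment x y (.fromWhite z)) - indic (InSegment x' y' (.fromWhite z)))
    (fun z => (indic (z = x) - indic (z = x')) - (indic (z = y) - indic (z = y')))
    (fun z => D z - D' z)
    (fun h => by
      rw [indic_congr (inSegment_outerBlack_iff x y h),
        indic_congr (inSegment_outerBlack_iff x' y' h)])
    (fun z => by
      rw [indic_inSegment_white hloop hxy, indic_inSegment_white hloop hxy']
      ring)
    (fun z => by rw [← hD, ← hD']; ring)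
    (fun i => by
      rw [indic_of_not (not_inSegment_source _ _ _), indic_of_not (not_inSegment_source _ _ _),
        sub_zero])
    (fun i => by
      rw [indic_of_not (not_inSegment_sink _ _ _), indic_of_not (not_inSegment_sink _ _ _),
        sub_zero])
  have hi : ∀ {z}, G.Reaches (G.source i) (.toWhite z) → ¬ InSegment x' y' (.toWhite z) :=
    fun hz h => hij (G.source_injective_of_reaches hz (hx'.trans (Reaches.of_transGen h.1)))
  have hj : ∀ {z}, G.Reaches (G.source j) (.toWhite z) → ¬ InSegment x y (.toWhite z) :=
    fun hz h => hij (G.source_injective_of_reaches (hx.trans (Reaches.of_transGen h.1)) hz)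
  refine ⟨P, Q, ?_, ?_, ?_⟩
  · convert hPQ using 2
    simp only [segmentCount]
    ring
  · have h := hW x x' hf
    rw [hDx, hDx', hDz' x (fun h => hff h.symm), hDz' x' (fun h => hff (hf.trans h.symm)),
      indic_of_not (hi hx), indic_of_not (hj hx'), indic_of_not (fun h => hloop _ h.1),
      indic_of_not (fun h => hloop _ h.1)] at h
    linarith
  · have h := hW y y' hf'
    rw [hDy, hDy', hDz y hff, hDz y' (fun h => hff (h.trans hf'.symm)),
      indic_of_not (hi hy), indic_of_not (hj hy'),
      indic_of (p := InSegment x y _) ⟨hxy, ReflTransGen.refl⟩,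
      indic_of (p := InSegment x' y' _) ⟨hxy', ReflTransGen.refl⟩] at h
    linarith

end BoundaryGraph

namespace BoundaryGraph

open Relation

variable {n : ℕ} {G : BoundaryGraph n}

/-! ### Strands of a minimal graph along a face -/

theorem IsTrivalent.black_black (h : G.IsTrivalent) (e : G.E) :
    G.black (G.black e) = G.black⁻¹ e := by
  rw [Equiv.Perm.eq_inv_iff_eq, (h e).2]

/-- In a minimal graph, a strand has a face on its left at most once. -/
theorem IsMinimal.not_reaches_of_sameCycle_face [NeZero n] (hG : G.IsBTB) (hmin : G.IsMinimal)
    {i : ZMod n} {x y : G.Half} (hne : x ≠ y) (hf : G.face.SameCycle x y)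
    (hx : G.Reaches (G.source i) (.toWhite x)) : ¬ G.Reaches (.toWhite x) (.toWhite y) := by
  intro hxy'
  have hloop := hmin.no_loop
  have hxy : TransGen G.Next (.toWhite x) (.toWhite y) := hxy'.transGen (by simpa using hne)
  obtain ⟨P, Q, hPQ⟩ := exists_segment_potential hG.planar hloop hxy hf
  have own : ∀ {d : G.Dart}, InSegment x y d → G.Reaches (G.source i) d := fun h =>
    hx.trans (Reaches.of_transGen h.1)
  have before : ∀ d f, d = .toWhite (Sum.inl f) ∨ d = .fromWhite (Sum.inl f) →
      G.Reaches (G.source i) d → G.Reaches d (.toWhite x) → segmentCount x y (Sum.inl f) = 0 := by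
    rintro d f hd h1 h2
    have hd' : ¬ InSegment x y d := fun h => hloop _ (h.1.trans_left h2)
    rcases hd with rfl | rfl
    · exact segmentCount_eq_zero hd' fun h => hmin.no_self_intersection i f ⟨h1, own h⟩
    · exact segmentCount_eq_zero (fun h => hmin.no_self_intersection i f ⟨own h, h1⟩) hd'
  -- Before `x` the strand cannot meet its own segment, so the winding number keeps its boundary
  -- value.
  have hPx : P x = 0 := by
    have hs : (G.source i).value P Q = 0 := hPQ.leg_white i
    by_contra h0
    rcases lt_or_gt_of_ne h0 with h0 | h0
    · rcases hPQ.exists_decrease hx (by rw [hs]; exact h0) with ⟨f, h1, h2, h3⟩ | ⟨f, h1, h2, h3⟩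
      · rw [before _ f (Or.inr rfl) (Reaches.of_transGen h1) h2] at h3
        exact lt_irrefl _ h3
      · rw [before _ f (Or.inl rfl) (Reaches.of_transGen h1) h2] at h3
        exact lt_irrefl _ h3
    · rcases hPQ.exists_increase hx (by rw [hs]; exact h0) with ⟨f, h1, h2, h3⟩ | ⟨f, h1, h2, h3⟩
      · rw [before _ f (Or.inr rfl) (Reaches.of_transGen h1) h2] at h3
        exact lt_irrefl _ h3
      · rw [before _ f (Or.inl rfl) (Reaches.of_transGen h1) h2] at h3
        exact lt_irrefl _ h3
  have hnx : G.Next (.toWhite x) (.fromWhite (G.white⁻¹ x)) := Next.atWhite x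
  have hexy := Reaches.of_next_of_transGen hnx hxy
  rcases he : G.white⁻¹ x with e | k
  swap
  · rw [he] at hexy
    have := Reaches.eq_of_sink (j := k) hexy
    cases this
  rw [he] at hnx hexy
  have hPe : P (Sum.inl e) = 0 := by
    rw [← hPQ.white, ← he, ← Equiv.Perm.mul_apply, mul_inv_cancel, Equiv.Perm.one_apply, hPx]
  have hne' : G.Next (.fromWhite (Sum.inl e)) (.toWhite (Sum.inl (G.black e))) := Next.atBlack e
  -- The passage of `e` puts its black endpoint inside the curve.
  have hQ : 0 < Q (Sum.inl (G.black e)) := by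
    have h1 : Q (Sum.inl (G.black e)) = Q (Sum.inl e) := hPQ.black (Sum.inl e)
    have h2 := hPQ.diff (Sum.inl e)
    have h3 := indic_nonneg (InSegment x y (.toWhite (Sum.inl e)))
    rw [segmentCount, indic_of (p := InSegment x y (.fromWhite (Sum.inl e)))
      ⟨TransGen.single hnx, hexy⟩] at h2
    linarith
  have hi1 : G.Reaches (G.source i) (.fromWhite (Sum.inl e)) := hx.tail hnx
  have hi2 : G.Reaches (G.source i) (.toWhite (Sum.inl (G.black e))) := hi1.tail hne'
  -- The strand `j` leaves this vertex along `black e`, against the strand `i`. It has to get out of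
  -- the curve, and so it crosses the segment again, at `f`.
  obtain ⟨j, hj⟩ := exists_source hloop (.fromWhite (Sum.inl (G.black e)))
  have hij : i ≠ j := by
    rintro rfl
    exact hmin.no_self_intersection i _ ⟨hi2, hj⟩
  obtain ⟨k, hk⟩ := exists_sink_of_source hj
  rcases hPQ.exists_decrease hk (by
    change Q (Sum.inr k) < Q _
    rwa [hPQ.leg_black]) with ⟨f, h1, h2, h3⟩ | ⟨f, h1, h2, h3⟩
  · exact absurd h3 (not_lt.2 (segmentCount_nonneg _ _ _))
  have hjf : G.Reaches (G.source j) (.toWhite (Sum.inl f)) := hj.trans (Reaches.of_transGen h1)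
  rcases of_segmentCount_pos h3 with h4 | h4
  · exact hij (G.source_injective_of_reaches (own h4) hjf)
  have h5 := Reaches.of_next_of_transGen hnx h4.1
  -- If `f` is the first edge of the segment, it precedes `black e` on the strand `i` and there is
  -- no parallel bigon. Instead `j` uses the third edge of the black vertex in both directions.
  by_cases hfe : e = f
  · subst hfe
    have hpred : G.Next (.fromWhite (Sum.inl (G.black (G.black e)))) (.toWhite (Sum.inl e)) := by
      rw [next_to_toWhite_iff, hG.trivalent.black_black]
    exact hmin.no_self_intersection j (G.black (G.black e))
      ⟨hj.tail (Next.atBlack _), Reaches.pred_of_source hpred hjf⟩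
  · have h6 := Reaches.of_next_of_transGen hne' (h5.transGen (by simpa using hfe))
    have hne'' : G.black e ≠ f := by
      rintro rfl
      exact hmin.no_self_intersection i _ ⟨hi2, own h4⟩
    exact hmin.no_parallel_bigon i j hij _ _ hne''
      ⟨⟨_, _, Or.inl rfl, Or.inr rfl, hi2, h6⟩,
        ⟨_, _, Or.inr rfl, Or.inl rfl, hj, Reaches.of_transGen h1⟩⟩

theorem IsMinimal.eq_of_sameCycle_face [NeZero n] (hG : G.IsBTB) (hmin : G.IsMinimal)
    {i : ZMod n} {x y : G.Half} (hf : G.face.SameCycle x y)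
    (hx : G.Reaches (G.source i) (.toWhite x)) (hy : G.Reaches (G.source i) (.toWhite y)) :
    x = y := by
  by_contra hne
  rcases hx.total_of_left hy with h | h
  · exact hmin.not_reaches_of_sameCycle_face hG hne hf hx h
  · exact hmin.not_reaches_of_sameCycle_face hG (Ne.symm hne) hf.symm hy h

section TwoSegments

variable {i j : ZMod n} {x y x' y' : G.Half}

/-- The first of two segments is crossed by its own strand, outside of it, only with the sign of the
other segment. -/
theorem IsMinimal.count_first (hmin : G.IsMinimal) (hx : G.Reaches (G.source i) (.toWhite x))
    {d : G.Dart} {f : G.E} (hd : d.IsOver f)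
    (h1 : G.Reaches (G.source i) d)
    (h2 : G.Reaches d (.toWhite x) ∨ TransGen G.Next (.toWhite y) d) :
    segmentCount x y (Sum.inl f) = 0 := by
  have own : ∀ {d : G.Dart}, InSegment x y d → G.Reaches (G.source i) d := fun h =>
    hx.trans (Reaches.of_transGen h.1)
  have hd' : ¬ InSegment x y d := fun h => by
    rcases h2 with h2 | h2
    · exact hmin.no_loop _ (h.1.trans_left h2)
    · exact hmin.no_loop _ (h2.trans_left h.2)
  rcases hd with rfl | rfl
  · exact segmentCount_eq_zero hd' fun h => hmin.no_self_intersection i f ⟨h1, own h⟩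
  · exact segmentCount_eq_zero (fun h => hmin.no_self_intersection i f ⟨own h, h1⟩) hd'

theorem crossing_of_segmentCount_pos_toWhite (hij : i ≠ j)
    (hx' : G.Reaches (G.source j) (.toWhite x')) {f : G.E}
    (h1 : G.Reaches (G.source i) (.toWhite (Sum.inl f)))
    (h : 0 < segmentCount x' y' (Sum.inl f)) : InSegment x' y' (.fromWhite (Sum.inl f)) :=
  (of_segmentCount_pos h).resolve_left fun h' =>
    hij (G.source_injective_of_reaches h1 (hx'.trans (Reaches.of_transGen h'.1)))

theorem crossing_of_segmentCount_pos_fromWhite (hij : i ≠ j)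
    (hx' : G.Reaches (G.source j) (.toWhite x')) {f : G.E}
    (h1 : G.Reaches (G.source i) (.fromWhite (Sum.inl f)))
    (h : 0 < segmentCount x' y' (Sum.inl f)) : InSegment x' y' (.toWhite (Sum.inl f)) :=
  (of_segmentCount_pos h).resolve_right fun h' =>
    hij (G.source_injective_of_reaches h1 (hx'.trans (Reaches.of_transGen h'.1)))

end TwoSegments

/-- In a minimal graph, two strands that have crossed each other, the second one from right to left
of the first one, do not both have a common face on their left afterwards. -/
theorem IsMinimal.not_common_face_after_crossing [NeZero n] (hG : G.IsBTB) (hmin : G.IsMinimal)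
    {i j : ZMod n} (hij : i ≠ j) {g : G.E} {y y' : G.Half}
    (hi : G.Reaches (G.source i) (.toWhite (Sum.inl g)))
    (hj : G.Reaches (G.source j) (.fromWhite (Sum.inl g)))
    (hy : G.Reaches (.toWhite (Sum.inl g)) (.toWhite y))
    (hy' : G.Reaches (.fromWhite (Sum.inl g)) (.toWhite y')) :
    ¬ G.face.SameCycle y y' := by
  intro hf'
  have hloop := hmin.no_loop
  have hn1 : G.Next (.toWhite (G.white (Sum.inl (G.black⁻¹ g))))
      (.fromWhite (Sum.inl (G.black⁻¹ g))) := by simp [next_toWhite_iff]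
  have hn2 : G.Next (.fromWhite (Sum.inl (G.black⁻¹ g))) (.toWhite (Sum.inl g)) := by
    simp [next_fromWhite_iff]
  have hn3 : G.Next (.fromWhite (Sum.inl g)) (.toWhite (Sum.inl (G.black g))) := Next.atBlack g
  -- Moving `i` back across the black endpoint of `g` and `j` one step forward gives two corners of
  -- one face, the face opposite to `g` at that vertex. The two segments can then be closed up at
  -- both ends.
  set x : G.Half := G.white (Sum.inl (G.black⁻¹ g)) with hxdef
  set x' : G.Half := Sum.inl (G.black g) with hxdef'
  have hx : G.Reaches (G.source i) (.toWhite x) :=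
    Reaches.pred_of_source hn1 (Reaches.pred_of_source hn2 hi)
  have hx' : G.Reaches (G.source j) (.toWhite x') := hj.tail hn3
  have hf : G.face.SameCycle x x' := by
    refine ⟨1, ?_⟩
    rw [zpow_one, hxdef, face_white, Equiv.Perm.inv_eq_iff_eq, hxdef']
    change _ = Sum.inl (G.black (G.black g))
    rw [hG.trivalent.black_black]
  have hxy : TransGen G.Next (.toWhite x) (.toWhite y) :=
    TransGen.head hn1 (TransGen.head' hn2 hy)
  have hff : ¬ G.face.SameCycle x y := fun h =>
    hmin.not_reaches_of_sameCycle_face hG (fun h => hloop _ (h ▸ hxy)) h hx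
      (Reaches.of_transGen hxy)
  have hxy' : TransGen G.Next (.toWhite x') (.toWhite y') := by
    refine Reaches.transGen
      (Reaches.of_next_of_transGen hn3 (hy'.transGen (by simp))) fun h => hff ?_
    simp only [Dart.toWhite.injEq] at h
    rw [h] at hf
    exact hf.trans hf'.symm
  obtain ⟨P, Q, hPQ, hPx, hPy⟩ :=
    exists_two_segment_potential hG.planar hloop hij hx hx' hxy hxy' hf hf' hff
  have hiy : G.Reaches (G.source i) (.toWhite y) := hi.trans hy
  have hjy : G.Reaches (G.source j) (.toWhite y') := hj.trans hy'
  -- Since `P y' = P y + 1`, either `P y < 0` or `P y' > 0`, and the corresponding strand must cross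
  -- the segment of the other one before its sink.
  rcases lt_or_ge (P y) 0 with h0 | h0
  · obtain ⟨k, hk⟩ := exists_sink_of_source hiy
    rcases hPQ.exists_increase hk (by
      change P y < Q (Sum.inr k)
      rwa [hPQ.leg_black]) with ⟨f, h1, h2, h3⟩ | ⟨f, h1, h2, h3⟩
    · have hif : G.Reaches (G.source i) _ := hiy.trans (Reaches.of_transGen h1)
      rw [hmin.count_first hx (Or.inr rfl) hif (Or.inr h1)] at h3
      have := segmentCount_nonneg x' y' (Sum.inl f)
      linarith
    · have hif : G.Reaches (G.source i) _ := hiy.trans (Reaches.of_transGen h1)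
      rw [hmin.count_first hx (Or.inl rfl) hif (Or.inr h1)] at h3
      have h4 := crossing_of_segmentCount_pos_toWhite hij hx' hif
        (by linarith : 0 < segmentCount x' y' (Sum.inl f))
      have h5 : TransGen G.Next (.fromWhite (Sum.inl g)) (.fromWhite (Sum.inl f)) :=
        TransGen.head hn3 h4.1
      have hgf : g ≠ f := by
        rintro rfl
        exact hloop _ h5
      exact hmin.no_parallel_bigon i j hij g f hgf
        ⟨⟨_, _, Or.inl rfl, Or.inl rfl, hi, hy.trans (Reaches.of_transGen h1)⟩,
          ⟨_, _, Or.inr rfl, Or.inr rfl, hj, Reaches.of_transGen h5⟩⟩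
  · obtain ⟨k, hk⟩ := exists_sink_of_source hjy
    rcases hPQ.exists_decrease hk (by
      change Q (Sum.inr k) < P y'
      rw [hPQ.leg_black]
      linarith) with ⟨f, h1, h2, h3⟩ | ⟨f, h1, h2, h3⟩
    · have hjf : G.Reaches (G.source j) _ := hjy.trans (Reaches.of_transGen h1)
      rw [hmin.count_first hx' (Or.inr rfl) hjf (Or.inr h1)] at h3
      have := segmentCount_nonneg x y (Sum.inl f)
      linarith
    · have hjf : G.Reaches (G.source j) _ := hjy.trans (Reaches.of_transGen h1)
      rw [hmin.count_first hx' (Or.inl rfl) hjf (Or.inr h1)] at h3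
      have h4 := crossing_of_segmentCount_pos_toWhite hij.symm hx hjf
        (by linarith : 0 < segmentCount x y (Sum.inl f))
      have h5 := Reaches.of_next_of_transGen hn1 h4.1
      have hif : G.Reaches (G.source i) (.fromWhite (Sum.inl f)) :=
        hx.trans (Reaches.of_transGen h4.1)
      have hgf : g ≠ f := by
        rintro rfl
        exact hmin.no_self_intersection i _ ⟨hi, hif⟩
      -- Here `f` precedes `g` on the strand `i`. The strand `j`, arriving along `f`, has come
      -- through `black g`, which it had already used in the other direction.
      by_cases hgf' : G.black⁻¹ g = f
      · have hpred : G.Next (.fromWhite (Sum.inl (G.black g))) (.toWhite (Sum.inl f)) := by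
          rw [next_fromWhite_iff, hG.trivalent.black_black, hgf']
        exact hmin.no_self_intersection j (G.black g) ⟨hx', Reaches.pred_of_source hpred hjf⟩
      · have h6 := Reaches.of_next_of_transGen hn2 (h5.transGen (by simpa using hgf'))
        exact hmin.no_parallel_bigon i j hij g f hgf
          ⟨⟨_, _, Or.inl rfl, Or.inr rfl, hi, h6⟩,
            ⟨_, _, Or.inr rfl, Or.inl rfl, hj, hy'.trans (Reaches.of_transGen h1)⟩⟩

/-- In a minimal graph, two strands do not have two common faces on their left in the same
order. -/
theorem IsMinimal.not_parallel_faces [NeZero n] (hG : G.IsBTB) (hmin : G.IsMinimal)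
    {i j : ZMod n} (hij : i ≠ j) {x y x' y' : G.Half}
    (hx : G.Reaches (G.source i) (.toWhite x)) (hx' : G.Reaches (G.source j) (.toWhite x'))
    (hxy : TransGen G.Next (.toWhite x) (.toWhite y))
    (hxy' : TransGen G.Next (.toWhite x') (.toWhite y'))
    (hf : G.face.SameCycle x x') : ¬ G.face.SameCycle y y' := by
  intro hf'
  have hloop := hmin.no_loop
  have hff : ¬ G.face.SameCycle x y := fun h =>
    hmin.not_reaches_of_sameCycle_face hG (fun h => hloop _ (h ▸ hxy)) h hx
      (Reaches.of_transGen hxy)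
  obtain ⟨P, Q, hPQ, hPx, hPy⟩ :=
    exists_two_segment_potential hG.planar hloop hij hx hx' hxy hxy' hf hf' hff
  -- The same alternative applies to the paths from the sources: one strand has crossed the segment
  -- of the other before the first face. The second common face then comes after that crossing on
  -- both strands.
  rcases lt_or_ge (P x) 0 with h0 | h0
  · rcases hPQ.exists_decrease hx (by
      change P x < P (Sum.inr i)
      rwa [hPQ.leg_white]) with ⟨f, h1, h2, h3⟩ | ⟨f, h1, h2, h3⟩
    · have hif : G.Reaches (G.source i) _ := Reaches.of_transGen h1
      rw [hmin.count_first hx (Or.inr rfl) hif (Or.inl h2)] at h3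
      have h4 := crossing_of_segmentCount_pos_fromWhite hij hx' hif
        (by linarith : 0 < segmentCount x' y' (Sum.inl f))
      exact hmin.not_common_face_after_crossing hG hij.symm
        (hx'.trans (Reaches.of_transGen h4.1)) hif h4.2
        (h2.trans (Reaches.of_transGen hxy)) hf'.symm
    · have hif : G.Reaches (G.source i) _ := Reaches.of_transGen h1
      rw [hmin.count_first hx (Or.inl rfl) hif (Or.inl h2)] at h3
      have := segmentCount_nonneg x' y' (Sum.inl f)
      linarith
  · rcases hPQ.exists_increase hx' (by
      change P (Sum.inr j) < P x'
      rw [hPQ.leg_white]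
      linarith) with ⟨f, h1, h2, h3⟩ | ⟨f, h1, h2, h3⟩
    · have hjf : G.Reaches (G.source j) _ := Reaches.of_transGen h1
      rw [hmin.count_first hx' (Or.inr rfl) hjf (Or.inl h2)] at h3
      have h4 := crossing_of_segmentCount_pos_fromWhite hij.symm hx hjf
        (by linarith : 0 < segmentCount x y (Sum.inl f))
      exact hmin.not_common_face_after_crossing hG hij
        (hx.trans (Reaches.of_transGen h4.1)) hjf h4.2
        (h2.trans (Reaches.of_transGen hxy')) hf'
    · have hjf : G.Reaches (G.source j) _ := Reaches.of_transGen h1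
      rw [hmin.count_first hx' (Or.inl rfl) hjf (Or.inl h2)] at h3
      have := segmentCount_nonneg x y (Sum.inl f)
      linarith

end BoundaryGraph

theorem perm_inv_apply_self {α : Type*} (p : Equiv.Perm α) (a : α) : p⁻¹ (p a) = a := by simp

theorem IsMerge.sameCycle_of_sameCycle {α β : Type} [Finite α] {τ : Equiv.Perm α}
    {τ' : Equiv.Perm β} {x y : α} {ι : β → α} (hm : IsMerge τ x y ι τ')
    (hinj : Function.Injective ι) (hι : Set.range ι = {x, y}ᶜ) (hxy : ¬ τ.SameCycle x y) {b b' : β}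
    (h : τ.SameCycle (ι b) (ι b')) : τ'.SameCycle b b' := by
  by_cases hb : τ.SameCycle x (ι b) ∨ τ.SameCycle y (ι b)
  · exact hm.sameCycle hinj hι hxy inferInstance hb (hb.imp (·.trans h) (·.trans h))
  · push Not at hb
    have key : ∀ k : ℕ, ι ((τ' ^ k) b) = (τ ^ k) (ι b) := by
      intro k
      induction k with
      | zero => rfl
      | succ k ih =>
        have hk : τ.SameCycle ((τ ^ k) (ι b)) (ι b) := Equiv.Perm.SameCycle.symm ⟨k, by simp⟩
        rw [pow_succ', pow_succ', Equiv.Perm.mul_apply, Equiv.Perm.mul_apply, hm.apply_of_not_mem,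
          ih]
        · rw [ih]; exact fun h => hb.1 (h.trans hk)
        · rw [ih]; exact fun h => hb.2 (h.trans hk)
    obtain ⟨k, hk⟩ := h.exists_nat_pow_eq
    rw [← key] at hk
    exact ⟨k, by simpa using hinj hk⟩

namespace BoundaryGraph

open Relation

variable {n : ℕ} {G H K S : BoundaryGraph n}

/-! ### The star graph and its splits follow the faces of the graph -/

/-- The zig-zag paths of `K` follow those of `G`: a path of `K` that goes through the edge `s` from
its white endpoint belongs to the visit of a face of `G` at the corner `v s`, and `ρ` orders the
edges on the same visit. -/
structure Follows (G K : BoundaryGraph n) (v : K.E → G.Half) (ρ : K.E → ℝ) : Prop where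
  black_ne : ∀ s, K.black s ≠ s
  black : ∀ s s', K.black.SameCycle s s' → s ≠ s' →
    v s ≠ v s' ∧ G.face.SameCycle (v s) (v s') ∧ 0 < ρ s + ρ s'
  white : ∀ s s', K.white (Sum.inl s') = Sum.inl s →
    TransGen G.Next (.toWhite (v (K.black⁻¹ s))) (.toWhite (v s')) ∨
      (v (K.black⁻¹ s) = v s' ∧ ρ s + ρ s' < 0)
  source : ∀ s i, K.white (Sum.inl s) = Sum.inr i → v s = Sum.inr i
  sink : ∀ s j, K.white (Sum.inr j) = Sum.inl s →
    G.Reaches (.toWhite (v (K.black⁻¹ s))) (G.sink (j + 1))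
  leg : ∀ i j, K.white (Sum.inr j) ≠ Sum.inr i

/-- A face with a single corner is either bounded by a double edge, which is a parallel bigon, or a
boundary face between two glued consecutive vertices. -/
theorem IsMinimal.face_ne [NeZero n] (hG : G.IsBTB) (hmin : G.IsMinimal)
    (hglue : ∀ i : ZMod n, ¬ G.Glued i (i + 1)) (c : G.Half) : G.face c ≠ c := by
  intro hc
  rw [face_eq_iff] at hc
  rcases c with e | i
  · have hc : G.white (Sum.inl (G.black e)) = Sum.inl e := hc
    have h1 : G.Next (.toWhite (Sum.inl e)) (.fromWhite (Sum.inl (G.black e))) := by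
      rw [next_to_fromWhite_iff, hc]
    have h2 : G.Next (.fromWhite (Sum.inl e)) (.toWhite (Sum.inl (G.black e))) := Next.atBlack e
    obtain ⟨i, hi⟩ := exists_source hmin.no_loop (.toWhite (Sum.inl e))
    obtain ⟨j, hj⟩ := exists_source hmin.no_loop (.fromWhite (Sum.inl e))
    have hij : i ≠ j := by
      rintro rfl
      exact hmin.no_self_intersection i e ⟨hi, hj⟩
    exact hmin.no_parallel_bigon i j hij e (G.black e) (hG.trivalent e).1.symm
      ⟨⟨_, _, Or.inl rfl, Or.inr rfl, hi, Reaches.of_next h1⟩,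
        ⟨_, _, Or.inr rfl, Or.inl rfl, hj, Reaches.of_next h2⟩⟩
  · have hc : G.white (Sum.inr (i + 1)) = Sum.inr i := hc
    exact hglue i (Equiv.Perm.SameCycle.symm ⟨1, by simpa using hc⟩)

theorem face_inv_apply (G : BoundaryGraph n) (c : G.Half) :
    G.face⁻¹ c = G.white (G.outerBlack c) := by
  simp [face]

theorem star_black_inv_corner [NeZero n] (G : BoundaryGraph n) (c : G.Half) :
    G.star.black⁻¹ (G.corner c) = G.corner (G.face⁻¹ c) := rfl

/-- Every passage of a white vertex inside the star graph moves on strictly in `G`, so the weight is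
constrained only at black vertices, and the constant `1` suffices. -/
theorem Follows.star [NeZero n] (hG : G.IsBTB) (hmin : G.IsMinimal)
    (hglue : ∀ i : ZMod n, ¬ G.Glued i (i + 1)) : Follows G G.star G.cornerOf fun _ => 1 where
  black_ne s := hmin.face_ne hG hglue (G.cornerOf s)
  black s s' h hne := ⟨hne, h, by norm_num⟩
  white s s' h := by
    left
    rcases s' with e | i
    · have hs : s = G.corner (Sum.inl (G.black e)) := (Sum.inl_injective h).symm
      rw [hs, star_black_inv_corner, cornerOf_corner, face_inv_apply]
      refine TransGen.head (b := .fromWhite (G.outerBlack (Sum.inl (G.black e))))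
        (by simp [next_toWhite_iff]) (TransGen.single ?_)
      change G.Next (.fromWhite (Sum.inl (G.black (G.black e)))) (.toWhite (Sum.inl e))
      rw [next_to_toWhite_iff, hG.trivalent.black_black]
    · cases h
  source s i h := by
    rcases s with e | j
    · cases h
    · have : j = i := Sum.inr_injective h
      rw [this]; rfl
  -- The corner before `inr j` on its boundary face is one from which the strand of `G` leaves at
  -- once by the leg `j + 1`. This is the origin of the shift by one.
  sink s j h := by
    have hs : s = G.corner (Sum.inr j) := (Sum.inl_injective h).symm
    rw [hs, star_black_inv_corner, cornerOf_corner, face_inv_apply]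
    exact Reaches.of_next (by simp [next_toWhite_iff, BoundaryGraph.sink, outerBlack])
  leg i j h := by cases h

/-- The vertices `v` of the new edges are dictated by the strands through the new white vertex. The
weights must satisfy `ρx > -ρ s` on the side of `x`, `ρy > -ρ t` on the side of `y`, and `ρx + ρy <
0`. This is possible because all sums `ρ s + ρ t` across the two sides were positive before the
split. -/
theorem Follows.split [NeZero n] {v : K.E → G.Half} {ρ : K.E → ℝ} (hK : Follows G K v ρ)
    {κ : K.E → H.E} (h : IsSplit K H κ) : ∃ (v' : H.E → G.Half) (ρ' : H.E → ℝ),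
      Follows G H v' ρ' ∧ ∀ s, v' (κ s) = v s ∧ v' (H.black⁻¹ (κ s)) = v (K.black⁻¹ s) := by
  classical
  obtain ⟨hinj, x, y, hxy, hκ, hwx, hwy, hb, hdx, hdy, hbm, hw⟩ := h
  have := H.finite
  have := K.finite
  have hm : IsMerge H.black x y κ K.black := isMerge_of_mergeCycles hb hκ hbm
  have hκne := ne_of_range_eq hκ
  have hex : ∀ a, a ≠ x → a ≠ y → ∃ b, κ b = a := fun a h1 h2 => by
    have : a ∈ Set.range κ := by rw [hκ]; simp [h1, h2]
    exact this
  have hbx : H.black x ≠ x := fun h => hdx (by rw [h, h])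
  have hby : H.black y ≠ y := fun h => hdy (by rw [h, h])
  obtain ⟨a, ha⟩ : ∃ a, κ a = H.black⁻¹ x := by
    refine hex _ (fun h => ?_) fun h => ?_
    · rw [Equiv.Perm.inv_eq_iff_eq] at h; exact hbx h.symm
    · exact hb (Equiv.Perm.SameCycle.symm ⟨1, by rw [← h]; simp⟩)
  obtain ⟨b, hb'⟩ : ∃ b, κ b = H.black⁻¹ y := by
    refine hex _ (fun h => ?_) fun h => ?_
    · exact hb ⟨1, by rw [← h]; simp⟩
    · rw [Equiv.Perm.inv_eq_iff_eq] at h; exact hby h.symm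
  have hax : H.black.SameCycle x (κ a) := ⟨-1, by simp [ha]⟩
  have hby' : H.black.SameCycle y (κ b) := ⟨-1, by simp [hb']⟩
  have hpos : ∀ {s t}, H.black.SameCycle x (κ s) → H.black.SameCycle y (κ t) →
      v s ≠ v t ∧ G.face.SameCycle (v s) (v t) ∧ 0 < ρ s + ρ t := by
    intro s t hs ht
    refine hK.black s t (hm.sameCycle hinj hκ hb inferInstance (Or.inl hs) (Or.inr ht)) ?_
    rintro rfl
    exact hb (hs.trans ht.symm)
  obtain ⟨s₀, hs₀, hmins⟩ := Set.exists_min_image {s | H.black.SameCycle x (κ s)} ρ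
    (Set.toFinite _) ⟨a, hax⟩
  obtain ⟨t₀, ht₀, hmint⟩ := Set.exists_min_image {s | H.black.SameCycle y (κ s)} ρ
    (Set.toFinite _) ⟨b, hby'⟩
  have hst := (hpos hs₀ ht₀).2.2
  -- Each weight exceeds its lower bound by a quarter of the available gap, which leaves the sum
  -- negative.
  obtain ⟨ρx, ρy, hρx, hρy, hρxy⟩ : ∃ ρx ρy : ℝ, 0 < ρx + ρ s₀ ∧ 0 < ρy + ρ t₀ ∧ ρx + ρy < 0 :=
    ⟨-ρ s₀ + (ρ s₀ + ρ t₀) / 4, -ρ t₀ + (ρ s₀ + ρ t₀) / 4, by linarith, by linarith, by linarith⟩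
  obtain ⟨r, hr⟩ : ∃ r : H.E → K.E, ∀ s, r (κ s) = s :=
    have : Nonempty K.E := ⟨a⟩
    ⟨Function.invFun κ, Function.leftInverse_invFun hinj⟩
  -- A strand that enters its new black vertex along `x` has just left the other one along `y`,
  -- which it entered along `b`; so it is still on the visit at the corner `v b`. The edge `y` is
  -- symmetric.
  let v' : H.E → G.Half := fun s => if s = x then v b else if s = y then v a else v (r s)
  let ρ' : H.E → ℝ := fun s => if s = x then ρx else if s = y then ρy else ρ (r s)
  have vx : v' x = v b := if_pos rfl
  have vy : v' y = v a := by simp only [v', if_neg hxy.symm, if_true]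
  have vκ : ∀ s, v' (κ s) = v s := fun s => by
    simp only [v', if_neg (hκne s).1, if_neg (hκne s).2, hr]
  have rx : ρ' x = ρx := if_pos rfl
  have ry : ρ' y = ρy := by simp only [ρ', if_neg hxy.symm, if_true]
  have rκ : ∀ s, ρ' (κ s) = ρ s := fun s => by
    simp only [ρ', if_neg (hκne s).1, if_neg (hκne s).2, hr]
  have hcases : ∀ s, s = x ∨ s = y ∨ ∃ t, s = κ t := fun s => by
    by_cases h1 : s = x
    · exact Or.inl h1
    by_cases h2 : s = y
    · exact Or.inr (Or.inl h2)
    · obtain ⟨t, ht⟩ := hex s h1 h2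
      exact Or.inr (Or.inr ⟨t, ht.symm⟩)
  have hstep : ∀ t, (t = a ∧ κ (K.black t) = H.black y) ∨ (t = b ∧ κ (K.black t) = H.black x) ∨
      κ (K.black t) = H.black (κ t) := by
    intro t
    have hta : H.black (κ t) = x → t = a := fun h => hinj (by
      rw [ha, Equiv.Perm.eq_inv_iff_eq, h])
    have htb : H.black (κ t) = y → t = b := fun h => hinj (by
      rw [hb', Equiv.Perm.eq_inv_iff_eq, h])
    rcases hm t with h | h | h | h | h
    · exact Or.inl ⟨hta h.1, h.2.2.2⟩
    · exact absurd h.2.2.1 hby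
    · exact Or.inr (Or.inl ⟨htb h.1, h.2.2.2⟩)
    · exact absurd h.2.2.1 hbx
    · exact Or.inr (Or.inr h.2.2)
  have vinv : ∀ s, v' (H.black⁻¹ (κ s)) = v (K.black⁻¹ s) := by
    intro s
    obtain ⟨t, rfl⟩ := K.black.surjective s
    have h0 : K.black⁻¹ (K.black t) = t := by simp
    rw [h0]
    rcases hstep t with ⟨h1, h2⟩ | ⟨h1, h2⟩ | h2
    · rw [h2, h1, perm_inv_apply_self, vy]
    · rw [h2, h1, perm_inv_apply_self, vx]
    · rw [h2, perm_inv_apply_self, vκ]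
  have vinvx : v' (H.black⁻¹ x) = v a := by rw [← ha, vκ]
  have vinvy : v' (H.black⁻¹ y) = v b := by rw [← hb', vκ]
  have hXκ : ∀ s, H.black.SameCycle x (κ s) →
      v' x ≠ v' (κ s) ∧ G.face.SameCycle (v' x) (v' (κ s)) ∧ 0 < ρ' x + ρ' (κ s) := by
    intro s hs
    obtain ⟨h1, h2, -⟩ := hpos hs hby'
    have h3 := hmins s hs
    rw [vx, vκ, rx, rκ]
    exact ⟨h1.symm, h2.symm, by linarith⟩
  have hYκ : ∀ s, H.black.SameCycle y (κ s) →
      v' y ≠ v' (κ s) ∧ G.face.SameCycle (v' y) (v' (κ s)) ∧ 0 < ρ' y + ρ' (κ s) := by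
    intro s hs
    obtain ⟨h1, h2, -⟩ := hpos hax hs
    have h3 := hmint s hs
    rw [vy, vκ, ry, rκ]
    exact ⟨h1, h2, by linarith⟩
  have hsymm : ∀ {s s'}, v' s ≠ v' s' ∧ G.face.SameCycle (v' s) (v' s') ∧ 0 < ρ' s + ρ' s' →
      v' s' ≠ v' s ∧ G.face.SameCycle (v' s') (v' s) ∧ 0 < ρ' s' + ρ' s := fun h =>
    ⟨h.1.symm, h.2.1.symm, by linarith [h.2.2]⟩
  refine ⟨v', ρ', ⟨?_, ?_, ?_, ?_, ?_, ?_⟩, fun s => ⟨vκ s, vinv s⟩⟩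
  · intro s
    rcases hcases s with rfl | rfl | ⟨t, rfl⟩
    · exact hbx
    · exact hby
    · intro h
      rcases hm t with h' | h' | h' | h' | h'
      · exact (hκne t).1 (h.symm.trans h'.1)
      · exact (hκne t).1 (h.symm.trans h'.1)
      · exact (hκne t).2 (h.symm.trans h'.1)
      · exact (hκne t).2 (h.symm.trans h'.1)
      · exact hK.black_ne t (hinj (h'.2.2.trans h))
  · intro s s' hss hne
    rcases hcases s with rfl | rfl | ⟨t, rfl⟩ <;> rcases hcases s' with rfl | rfl | ⟨t', rfl⟩
    · exact absurd rfl hne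
    · exact absurd hss hb
    · exact hXκ _ hss
    · exact absurd hss.symm hb
    · exact absurd rfl hne
    · exact hYκ _ hss
    · exact hsymm (hXκ _ hss.symm)
    · exact hsymm (hYκ _ hss.symm)
    · rw [vκ, vκ, rκ, rκ]
      exact hK.black t t' (hm.sameCycle_of_sameCycle hinj hκ hb hss) fun h => hne (h ▸ rfl)
  · intro s s' hs
    rcases hcases s' with rfl | rfl | ⟨t', rfl⟩
    · rw [hwx, Sum.inl.injEq] at hs
      subst hs
      exact Or.inr ⟨by rw [vinvy, vx], by rw [rx, ry]; linarith⟩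
    · rw [hwy, Sum.inl.injEq] at hs
      subst hs
      exact Or.inr ⟨by rw [vinvx, vy], by rw [rx, ry]; linarith⟩
    · have h1 := hw (Sum.inl t')
      rw [Sum.map_inl, hs] at h1
      rcases ht : K.white (Sum.inl t') with t | i
      · rw [ht, Sum.map_inl, Sum.inl.injEq] at h1
        subst h1
        rw [vinv, vκ, rκ, rκ]
        exact hK.white t t' ht
      · rw [ht] at h1
        cases h1
  · intro s i hs
    rcases hcases s with rfl | rfl | ⟨t, rfl⟩
    · rw [hwx] at hs; cases hs
    · rw [hwy] at hs; cases hs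
    · have h1 := hw (Sum.inl t)
      rw [Sum.map_inl, hs] at h1
      rw [vκ]
      rcases ht : K.white (Sum.inl t) with t' | i'
      · rw [ht] at h1; cases h1
      · rw [ht] at h1
        have h2 : i' = i := Sum.inr_injective h1
        exact hK.source t i (h2 ▸ ht)
  · intro s j hs
    have h1 := hw (Sum.inr j)
    rw [Sum.map_inr, id, hs] at h1
    rcases ht : K.white (Sum.inr j) with t | i
    · rw [ht, Sum.map_inl, Sum.inl.injEq] at h1
      subst h1
      rw [vinv]
      exact hK.sink t j ht
    · rw [ht] at h1; cases h1
  · intro i j hs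
    have h1 := hw (Sum.inr j)
    rw [Sum.map_inr, id, hs] at h1
    rcases ht : K.white (Sum.inr j) with t | i'
    · rw [ht] at h1; cases h1
    · exact hK.leg _ _ ht

theorem Splits.exists_follows [NeZero n] {v : K.E → G.Half} {ρ : K.E → ℝ} (hK : Follows G K v ρ)
    {ι : K.E → H.E} (h : Splits K H ι) : ∃ (v' : H.E → G.Half) (ρ' : H.E → ℝ),
      Follows G H v' ρ' ∧ ∀ s, v' (ι s) = v s ∧ v' (H.black⁻¹ (ι s)) = v (K.black⁻¹ s) := by
  induction h with
  | refl => exact ⟨v, ρ, hK, fun s => ⟨rfl, rfl⟩⟩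
  | step _ hs ih =>
    obtain ⟨v₁, ρ₁, h1, h2⟩ := ih
    obtain ⟨v₂, ρ₂, h3, h4⟩ := h1.split hs
    exact ⟨v₂, ρ₂, h3, fun s => ⟨(h4 _).1.trans (h2 s).1, (h4 _).2.trans (h2 s).2⟩⟩

theorem exists_isOver_of_next_of_next {c d d' : K.Dart} (h : K.Next d c) (h' : K.Next c d') :
    ∃ e, c.IsOver e := by
  rcases c with (e | i) | (e | i)
  · exact ⟨e, Or.inl rfl⟩
  · exact absurd h (K.not_next_source _ _)
  · exact ⟨e, Or.inr rfl⟩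
  · exact absurd h' (K.not_sink_next _ _)

/-! ### Minimality of graphs that follow a minimal graph. -/

section Follows

variable {v : K.E → G.Half} {ρ : K.E → ℝ}

/-- The directed edge of `G` that represents the visit of a directed edge of `K`. -/
def visit (v : K.E → G.Half) : K.Dart → G.Dart
  | .toWhite (Sum.inl s) => .toWhite (v (K.black⁻¹ s))
  | .toWhite (Sum.inr i) => G.source i
  | .fromWhite (Sum.inl s) => .toWhite (v s)
  | .fromWhite (Sum.inr j) => G.sink (j + 1)

/-- The position of a directed edge of `K` on its visit. -/
def position (ρ : K.E → ℝ) : K.Dart → ℝ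
  | .toWhite (Sum.inl s) => ρ s
  | .toWhite (Sum.inr _) => 0
  | .fromWhite (Sum.inl s) => -ρ s
  | .fromWhite (Sum.inr _) => 0

/-- The order along zig-zag paths, as seen in `G`. -/
def Precedes (v : K.E → G.Half) (ρ : K.E → ℝ) (d d' : K.Dart) : Prop :=
  TransGen G.Next (visit v d) (visit v d') ∨
    (visit v d = visit v d' ∧ position ρ d < position ρ d')

theorem Precedes.trans {d d' d'' : K.Dart} (h : Precedes v ρ d d') (h' : Precedes v ρ d' d'') :
    Precedes v ρ d d'' := by
  rcases h with h | ⟨h1, h2⟩ <;> rcases h' with h' | ⟨h1', h2'⟩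
  · exact Or.inl (h.trans h')
  · exact Or.inl (h1' ▸ h)
  · exact Or.inl (h1 ▸ h')
  · exact Or.inr ⟨h1.trans h1', h2.trans h2'⟩

theorem Follows.reaches_of_next (hK : Follows G K v ρ) {d d' : K.Dart} (h : K.Next d d') :
    G.Reaches (visit v d) (visit v d') := by
  cases h with
  | atWhite z =>
    rcases z with s | i <;> rcases hz : K.white⁻¹ _ with s' | j
    · rw [Equiv.Perm.inv_eq_iff_eq] at hz
      rcases hK.white s s' hz.symm with h | ⟨h, -⟩
      · exact Reaches.of_transGen h
      · change G.Reaches (.toWhite (v (K.black⁻¹ s))) (.toWhite (v s'))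
        rw [h]
        exact Reaches.refl _
    · rw [Equiv.Perm.inv_eq_iff_eq] at hz
      exact hK.sink s j hz.symm
    · rw [Equiv.Perm.inv_eq_iff_eq] at hz
      change G.Reaches (G.source i) (.toWhite (v s'))
      rw [hK.source s' i hz.symm]
      exact Reaches.refl _
    · rw [Equiv.Perm.inv_eq_iff_eq] at hz
      exact absurd hz.symm (hK.leg _ _)
  | atBlack s =>
    change G.Reaches (.toWhite (v s)) (.toWhite (v (K.black⁻¹ (K.black s))))
    rw [perm_inv_apply_self]
    exact Reaches.refl _

theorem Follows.reaches (hK : Follows G K v ρ) {d d' : K.Dart} (h : K.Reaches d d') :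
    G.Reaches (visit v d) (visit v d') :=
  ReflTransGen.lift' (visit v) (fun _ _ h => hK.reaches_of_next h) _ _ h

theorem Follows.precedes_of_next (hK : Follows G K v ρ) {d d' : K.Dart} {e f : K.E}
    (hd : d.IsOver e) (hd' : d'.IsOver f) (h : K.Next d d') : Precedes v ρ d d' := by
  rcases hd with rfl | rfl
  · rw [next_toWhite_iff] at h
    rcases hd' with rfl | rfl
    · cases h
    · simp only [Dart.fromWhite.injEq] at h
      have h' : K.white (Sum.inl f) = Sum.inl e := by rw [h]; simp
      rcases hK.white e f h' with h | ⟨h1, h2⟩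
      · exact Or.inl h
      · exact Or.inr ⟨congrArg Dart.toWhite h1, by change ρ e < -ρ f; linarith⟩
  · rw [next_fromWhite_iff] at h
    subst h
    refine Or.inr ⟨?_, ?_⟩
    · change Dart.toWhite (v e) = .toWhite (v (K.black⁻¹ (K.black e)))
      rw [perm_inv_apply_self]
    · have := (hK.black e (K.black e) ⟨1, by simp⟩ (hK.black_ne e).symm).2.2
      change -ρ e < ρ (K.black e)
      linarith

theorem Follows.precedes (hK : Follows G K v ρ) {d d' : K.Dart} {e f : K.E}
    (hd : d.IsOver e) (hd' : d'.IsOver f) (h : TransGen K.Next d d') : Precedes v ρ d d' := by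
  induction h generalizing f with
  | single h => exact hK.precedes_of_next hd hd' h
  | @tail b c hdb hbc ih =>
    obtain ⟨b', -, hb'⟩ := TransGen.tail'_iff.1 hdb
    obtain ⟨g, hg⟩ := exists_isOver_of_next_of_next hb' hbc
    exact (ih hg).trans (hK.precedes_of_next hg hd' hbc)

/-- Both strands through an edge visit the same face of `G`, at the corners `v e` and `v (K.black⁻¹
e)`, with opposite positions. Each forbidden configuration thus becomes a statement about faces on
the left of strands of `G`, or about the order of positions. -/
theorem Follows.isMinimal [NeZero n] (hG : G.IsBTB) (hmin : G.IsMinimal) (hK : Follows G K v ρ) :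
    K.IsMinimal := by
  have hvis : ∀ e, v (K.black⁻¹ e) ≠ v e ∧ G.face.SameCycle (v (K.black⁻¹ e)) (v e) := fun e => by
    have := hK.black (K.black⁻¹ e) e ⟨1, by simp⟩ (fun h => hK.black_ne e (by
      rw [Equiv.Perm.inv_eq_iff_eq] at h; exact h.symm))
    exact ⟨this.1, this.2.1⟩
  have hsrc : ∀ {i d}, K.Reaches (K.source i) d → G.Reaches (G.source i) (visit v d) :=
    fun h => hK.reaches h
  refine ⟨?_, ?_, ?_⟩
  · intro d hd
    obtain ⟨b, -, hb⟩ := TransGen.tail'_iff.1 hd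
    obtain ⟨c, hc, -⟩ := TransGen.head'_iff.1 hd
    obtain ⟨e, he⟩ := exists_isOver_of_next_of_next hb hc
    rcases hK.precedes he he hd with h | ⟨-, h⟩
    · exact hmin.no_loop _ h
    · exact lt_irrefl _ h
  · rintro i e ⟨h1, h2⟩
    exact (hvis e).1 (hmin.eq_of_sameCycle_face hG (hvis e).2 (hsrc h1) (hsrc h2))
  · rintro i j hij e f hef ⟨⟨c, d, hc, hd, hic, hcd⟩, ⟨c', d', hc', hd', hjc', hcd'⟩⟩
    have hopp : ∀ {g : K.E} {a b : K.Dart}, a.IsOver g → b.IsOver g →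
        K.Reaches (K.source i) a → K.Reaches (K.source j) b →
        ∃ z z', visit v a = .toWhite z ∧ visit v b = .toWhite z' ∧ G.face.SameCycle z z' ∧
          position ρ b = -position ρ a := by
      intro g a b ha hb hia hjb
      rcases ha with rfl | rfl <;> rcases hb with rfl | rfl
      · exact absurd (K.source_injective_of_reaches hia hjb) hij
      · exact ⟨_, _, rfl, rfl, (hvis g).2, rfl⟩
      · exact ⟨_, _, rfl, rfl, (hvis g).2.symm, (neg_neg _).symm⟩
      · exact absurd (K.source_injective_of_reaches hia hjb) hij
    have hne : ∀ {a b : K.Dart}, a.IsOver e → b.IsOver f → a ≠ b := by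
      rintro a b (rfl | rfl) (rfl | rfl) h <;> simp at h <;> exact hef h
    have hid : K.Reaches (K.source i) d := hic.trans hcd
    have hjd' : K.Reaches (K.source j) d' := hjc'.trans hcd'
    obtain ⟨z, z', hz, hz', hzz, hp⟩ := hopp hc hc' hic hjc'
    obtain ⟨y, y', hy, hy', hyy, hq⟩ := hopp hd hd' hid hjd'
    have hix := hsrc hic
    have hiy := hsrc hid
    have hjx := hsrc hjc'
    have hjy := hsrc hjd'
    have hlt := hK.precedes hc hd (hcd.transGen (hne hc hd))
    have hlt' := hK.precedes hc' hd' (hcd'.transGen (hne hc' hd'))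
    unfold Precedes at hlt hlt'
    rw [hz] at hix
    rw [hz'] at hjx
    rw [hy] at hiy
    rw [hy'] at hjy
    rw [hz, hy, Dart.toWhite.injEq] at hlt
    rw [hz', hy', Dart.toWhite.injEq] at hlt'
    rcases hlt with hlt | ⟨h1, h2⟩ <;> rcases hlt' with hlt' | ⟨h1', h2'⟩
    · exact hmin.not_parallel_faces hG hij hix hjx hlt hlt' hzz hyy
    -- One strand meets both edges during a single visit, so they belong to one face, and the other
    -- strand would have this face on its left twice.
    · subst h1'
      have := hmin.eq_of_sameCycle_face hG (hzz.trans hyy.symm) hix hiy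
      exact hmin.no_loop _ (this ▸ hlt)
    · subst h1
      have := hmin.eq_of_sameCycle_face hG (hzz.symm.trans hyy) hjx hjy
      exact hmin.no_loop _ (this ▸ hlt')
    -- Both strands stay within one visit; opposite positions reverse the order.
    · rw [hp, hq] at h2'
      linarith

end Follows

/-! ### Contractions -/

/-- The inclusion of directed edges along an inclusion of edges. -/
def dartMap (κ : S.E → K.E) : S.Dart → K.Dart
  | .toWhite x => .toWhite (Sum.map κ id x)
  | .fromWhite x => .fromWhite (Sum.map κ id x)

theorem dartMap_comp (ι : H.E → K.E) (κ : S.E → H.E) (d : S.Dart) :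
    dartMap (ι ∘ κ) d = dartMap ι (dartMap κ d) := by
  rcases d with (_ | _) | (_ | _) <;> rfl

theorem dartMap_id (d : K.Dart) : dartMap (id : K.E → K.E) d = d := by
  rcases d with (_ | _) | (_ | _) <;> rfl

/-- A step past a merged white vertex lifts to a path through the contracted black vertex. If the
far white vertex has no other edge or leg, the path turns around there and comes back through the
black vertex. -/
theorem IsContraction.transGen {κ : S.E → K.E} (h : IsContraction K S κ) {d d' : S.Dart}
    (hd : S.Next d d') : TransGen K.Next (dartMap κ d) (dartMap κ d') := by
  obtain ⟨hinj, x, y, hxy, hκ, hbx, hby, hw, hb, hwm⟩ := h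
  have hm : IsMerge K.white (Sum.inl x) (Sum.inl y) (Sum.map κ id) S.white :=
    isMerge_of_mergeCycles hw (range_sumMap_id hκ) hwm
  have hBx : K.Next (.fromWhite (Sum.inl x)) (.toWhite (Sum.inl y)) := by
    rw [next_fromWhite_iff, hbx]
  have hBy : K.Next (.fromWhite (Sum.inl y)) (.toWhite (Sum.inl x)) := by
    rw [next_fromWhite_iff, hby]
  cases hd with
  | atWhite z =>
    obtain ⟨u, rfl⟩ := S.white.surjective z
    rw [perm_inv_apply_self]
    change TransGen K.Next (.toWhite (Sum.map κ id (S.white u))) (.fromWhite (Sum.map κ id u))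
    have hW : ∀ h, K.Next (.toWhite (K.white h)) (.fromWhite h) := fun h =>
      next_to_fromWhite_iff.2 rfl
    have hWx : TransGen K.Next (.toWhite (K.white (Sum.inl x))) (.toWhite (Sum.inl y)) :=
      TransGen.head (hW _) (TransGen.single hBx)
    have hWy : TransGen K.Next (.toWhite (K.white (Sum.inl y))) (.toWhite (Sum.inl x)) :=
      TransGen.head (hW _) (TransGen.single hBy)
    have hWu := hW (Sum.map κ id u)
    rcases hm u with h | h | h | h | h
    · rw [h.1] at hWu
      rw [h.2.2.2]
      exact hWy.tail hWu
    · rw [h.1] at hWu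
      rw [h.2.2.1] at hWy
      rw [h.2.2.2]
      exact (hWx.trans hWy).tail hWu
    · rw [h.1] at hWu
      rw [h.2.2.2]
      exact hWx.tail hWu
    · rw [h.1] at hWu
      rw [h.2.2.1] at hWx
      rw [h.2.2.2]
      exact (hWy.trans hWx).tail hWu
    · rw [h.2.2]
      exact TransGen.single hWu
  | atBlack e =>
    change TransGen K.Next (.fromWhite (Sum.inl (κ e))) (.toWhite (Sum.inl (κ (S.black e))))
    rw [hb]
    exact TransGen.single (Next.atBlack _)

theorem Contractions.injective {κ : S.E → K.E} (h : Contractions K S κ) :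
    Function.Injective κ := by
  induction h with
  | refl => exact Function.injective_id
  | step _ hs ih => exact ih.comp hs.1

theorem Contractions.transGen {κ : S.E → K.E} (h : Contractions K S κ) {d d' : S.Dart}
    (hd : S.Next d d') : TransGen K.Next (dartMap κ d) (dartMap κ d') := by
  induction h with
  | refl => rw [dartMap_id, dartMap_id]; exact TransGen.single hd
  | step _ hs ih =>
    rw [dartMap_comp, dartMap_comp]
    exact TransGen.lift' (dartMap _) (fun _ _ h => ih h) _ _ (hs.transGen hd)

theorem Contractions.reaches {κ : S.E → K.E} (h : Contractions K S κ) {d d' : S.Dart}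
    (hd : S.Reaches d d') : K.Reaches (dartMap κ d) (dartMap κ d') :=
  ReflTransGen.lift' (dartMap κ) (fun _ _ hn => Reaches.of_transGen (h.transGen hn)) _ _ hd

theorem Dart.IsOver.dartMap {κ : S.E → K.E} {d : S.Dart} {e : S.E} (h : d.IsOver e) :
    (BoundaryGraph.dartMap κ d).IsOver (κ e) := by
  rcases h with rfl | rfl
  · exact Or.inl rfl
  · exact Or.inr rfl

theorem Contractions.isMinimal {κ : S.E → K.E} (h : Contractions K S κ) (hK : K.IsMinimal) :
    S.IsMinimal := by
  refine ⟨fun d hd => ?_, ?_, ?_⟩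
  · exact hK.no_loop _ (TransGen.lift' (dartMap κ) (fun _ _ hn => h.transGen hn) _ _ hd)
  · rintro i e ⟨h1, h2⟩
    exact hK.no_self_intersection i (κ e) ⟨h.reaches h1, h.reaches h2⟩
  · rintro i j hij e f hef ⟨⟨c, d, hc, hd, h1, h2⟩, ⟨c', d', hc', hd', h1', h2'⟩⟩
    exact hK.no_parallel_bigon i j hij (κ e) (κ f) (fun h' => hef (h.injective h'))
      ⟨⟨_, _, hc.dartMap, hd.dartMap, h.reaches h1, h.reaches h2⟩,
        ⟨_, _, hc'.dartMap, hd'.dartMap, h.reaches h1', h.reaches h2'⟩⟩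

/-! ### Strands and sources -/

theorem strandOf_eq_of_reaches {d d' : G.Dart} (h : G.Reaches d d') :
    G.strandOf d = G.strandOf d' := by
  induction h with
  | refl => rfl
  | tail _ h ih => exact ih.trans (Quot.sound h)

/-- Without closed loops, the strands are numbered by their sources. -/
noncomputable def sourceEquiv [NeZero n] (hloop : ∀ d : G.Dart, ¬ TransGen G.Next d d) :
    ZMod n ≃ G.Strand :=
  Equiv.ofBijective (fun i => G.strandOf (G.source i)) (by
    have hs := exists_source hloop
    constructor
    · intro i j hij
      let f : G.Strand → ZMod n := Quot.lift (fun d => (hs d).choose) fun d d' hd =>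
        G.source_injective_of_reaches ((hs d).choose_spec.tail hd) (hs d').choose_spec
      have hf : ∀ i, f (G.strandOf (G.source i)) = i := fun i =>
        G.source_injective_of_reaches (hs (G.source i)).choose_spec (Reaches.refl _)
      rw [← hf i, ← hf j]
      exact congrArg f hij
    · rintro ⟨d⟩
      obtain ⟨i, hi⟩ := hs d
      exact ⟨i, strandOf_eq_of_reaches hi⟩)

theorem sourceEquiv_apply [NeZero n] (hloop : ∀ d : G.Dart, ¬ TransGen G.Next d d) (i : ZMod n) :
    sourceEquiv hloop i = G.strandOf (G.source i) := rfl

end BoundaryGraph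

/-! ### The proposition for section graphs. -/

open BoundaryGraph

theorem mainTheorem7 (n : ℕ) [NeZero n] (G : BoundaryGraph n)
    (hG : G.IsBTB) (hmin : G.IsMinimal)
    (hglue : ∀ i : ZMod n, ¬ G.Glued i (i + 1))
    (S H : BoundaryGraph n) (ι : G.star.E → H.E) (κ : S.E → H.E)
    (hS : BoundaryGraph.IsSection G S H ι κ) :
    (∃ Φ : G.Strand ≃ S.Strand,
      (∀ i : ZMod n, Φ (G.strandOf (G.source i)) = S.strandOf (S.source i)) ∧
      ∀ (e : G.E) (s : S.E), BoundaryGraph.EdgesCorrespond ι κ e s →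
        Φ (G.strandOf (.toWhite (Sum.inl e))) = S.strandOf (.toWhite (Sum.inl s)) ∧
        Φ (G.strandOf (.fromWhite (Sum.inl e))) = S.strandOf (.fromWhite (Sum.inl s))) ∧
    (∀ i : ZMod n, S.strandPerm i = G.strandPerm i - 1) ∧
    (S.IsBTB ∧ S.IsMinimal) := by
  obtain ⟨v, ρ, hH, hv⟩ := hS.splits.exists_follows (Follows.star hG hmin hglue)
  have hSmin : S.IsMinimal := hS.contractions.isMinimal (hH.isMinimal hG hmin)
  have hSplanar : S.IsPlanar :=
    hS.contractions.isPlanar (hS.splits.isPlanar (G.isPlanar_star hG.planar))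
  have hfol : ∀ {i d}, S.Reaches (S.source i) d →
      G.Reaches (G.source i) (visit v (dartMap κ d)) := fun h =>
    hH.reaches (hS.contractions.reaches h)
  refine ⟨⟨(sourceEquiv hmin.no_loop).symm.trans (sourceEquiv hSmin.no_loop), ?_, ?_⟩, ?_,
    ⟨hSplanar, hS.trivalent⟩, hSmin⟩
  · intro i
    rw [← sourceEquiv_apply hmin.no_loop, Equiv.trans_apply, Equiv.symm_apply_apply,
      sourceEquiv_apply]
  · intro e s hes
    have key : ∀ {i d d'}, G.Reaches (G.source i) d → S.Reaches (S.source i) d' →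
        ((sourceEquiv hmin.no_loop).symm.trans (sourceEquiv hSmin.no_loop)) (G.strandOf d) =
          S.strandOf d' := by
      intro i d d' h h'
      rw [← strandOf_eq_of_reaches h, ← strandOf_eq_of_reaches h',
        ← sourceEquiv_apply hmin.no_loop, Equiv.trans_apply, Equiv.symm_apply_apply,
        sourceEquiv_apply]
    have hes' : κ s = ι (G.corner (Sum.inl (G.black e))) := hes
    obtain ⟨hv1, hv2⟩ := hv (G.corner (Sum.inl (G.black e)))
    rw [star_black_inv_corner, cornerOf_corner, face_inv_apply, ← hes'] at hv2
    rw [cornerOf_corner, ← hes'] at hv1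
    constructor
    · obtain ⟨i, hi⟩ := exists_source hSmin.no_loop (.toWhite (Sum.inl s))
      refine key ?_ hi
      have h1 : G.Reaches (G.source i) (.toWhite (v (H.black⁻¹ (κ s)))) := hfol hi
      rw [hv2] at h1
      -- The visit is represented by its beginning; the strand of `G` reaches `toWhite e` two steps
      -- later, after the black endpoint of `e`.
      have h2 : G.Next (.toWhite (G.white (G.outerBlack (Sum.inl (G.black e)))))
          (.fromWhite (Sum.inl (G.black (G.black e)))) := next_to_fromWhite_iff.2 rfl
      have h3 : G.Next (.fromWhite (Sum.inl (G.black (G.black e)))) (.toWhite (Sum.inl e)) := by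
        rw [next_to_toWhite_iff, hG.trivalent.black_black]
      exact (h1.tail h2).tail h3
    · obtain ⟨i, hi⟩ := exists_source hSmin.no_loop (.fromWhite (Sum.inl s))
      refine key ?_ hi
      have h1 : G.Reaches (G.source i) (.toWhite (v (κ s))) := hfol hi
      rw [hv1] at h1
      exact Reaches.pred_of_source (Next.atBlack e) h1
  · intro i
    have h1 : S.Reaches (S.source i) (S.sink (S.strandPerm i)) := (S.strandPerm_eq_iff i _).1 rfl
    -- `visit` sends the sink `j` of the section graph to the sink `j + 1` of `G`.
    have h2 : G.Reaches (G.source i) (G.sink (S.strandPerm i + 1)) := hfol h1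
    rw [(G.strandPerm_eq_iff i _).2 h2, add_sub_cancel_right]
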